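/- **Setting.** Let $\mathcal H$ be a separable complex Hilbert space and let $\Xi$ be the real vector space of self-adjoint trace-class operators of trace $0$ on $\mathcal H$, with the Hilbert–Schmidt inner product $(\phi,\chi)_\Xi=\operatorname{Tr}[\phi^*\chi]$; let $\overline\Xi$ be its Hilbert space completion (equal to $\Xi$ if $\dim\mathcal H<\infty$). Fix a density operator $\rho_0$, put $\rho(\theta)=\rho_0+\theta$ for $\theta\in\Xi$, and let $\theta\in\Theta=\{\theta'\in\Xi:\rho_0+\theta'>0\}$ (strictly positive). **Measurement.** Let $M$ be a POVM on a measurable space $(\Omega,\mathfrak B)$ and $P_{\theta'}(E)=\operatorname{Tr}[\rho(\theta')M(E)]$. Suppose that for every $E\in\mathfrak B$ the function $\theta'\mapsto P_{\theta'}(E)$ on $\Xi$ is Fréchet differentiable at $\theta$ and that there is $\kappa\in L^2(\Omega,P_\theta;\overline\Xi)$ (the logarithmic gradient) with $$D_\theta P_\theta(E)[\phi]=\int_E(\kappa(x),\phi)\,P_\theta(dx)\qquad(E\in\mathfrak B,\ \phi\in\Xi).$$ The Fisher information operator is $J^M_\theta=\mathbb E_\theta[\kappa\kappa^*]$, that is,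 $J^M_\theta\chi=\int(\kappa(x),\chi)\,\kappa(x)\,P_\theta(dx)$ on $\overline\Xi$. Let $(J^M_\theta)^+$ be a Moore–Penrose inverse of $J=J^M_\theta$, i.e. a linear operator, possibly unbounded, whose domain contains the range of $J$, with $JJ^+J=J$, $J^+JJ^+=J^+$, and with $JJ^+$ and $J^+J$ symmetric. **Observables.** For a densely defined operator $X$ write $X\in\tilde{\mathcal O}$ if $\rho(\theta)X$ extends to a trace-class operator, and then $\langle X\rangle_\theta=\operatorname{Tr}[\rho(\theta)X]$ denotes the trace of that extension; similarly for the other values of the parameter. Let $A,B$ be (possibly unbounded) self-adjoint operators with $A,B,A^2,B^2,AB\in\tilde{\mathcal O}$, such that $\theta'\mapsto\langle A\rangle_{\theta'}$ and $\theta'\mapsto\langle B\rangle_{\theta'}$ have gradients $\nabla_\theta\langle A\rangle_\theta,\nabla_\theta\langle B\rangle_\theta\in\overline\Xi$ at $\theta$ (Fréchet derivatives along the set of $\theta'\in\Xi$ at which the expectation value is finite) that lie in the domain of $(J^M_\theta)^+$. Put $$C_\theta(A,B)=\langle AB\rangle_\theta-\langle A\rangle_\theta\langle B\rangle_\theta,\quad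 C^{\mathrm S}_\theta(A,B)=\tfrac12\{C_\theta(A,B)+C_\theta(B,A)\},\quad \sigma^2_\theta(A)=C_\theta(A,A),$$ $$\varepsilon(A;\rho(\theta),M)=\begin{cases}\big(\nabla_\theta\langle A\rangle_\theta,(J^M_\theta)^+\nabla_\theta\langle A\rangle_\theta\big)-\sigma_\theta^2(A)&\text{if }\nabla_\theta\langle A\rangle_\theta\in(\ker J^M_\theta)^\perp,\\+\infty&\text{otherwise,}\end{cases}$$ and likewise for $B$. **Theorem.** Under these assumptions $$\varepsilon(A;\rho(\theta),M)\,\varepsilon(B;\rho(\theta),M)\ \ge\ \mathcal R^M(A,B)^2+\tfrac14\big|\langle[A,B]\rangle_\theta\big|^2,$$ where $\mathcal R^M(A,B)=\big(\nabla_\theta\langle A\rangle_\theta,(J^M_\theta)^+\nabla_\theta\langle B\rangle_\theta\big)-C^{\mathrm S}_\theta(A,B)$ and $[A,B]=AB-BA$. A product with a factor $+\infty$ is read as $+\infty$ (also $0\cdot\infty=\infty$). -/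

import Mathlib

open MeasureTheory Set
open scoped ENNReal ComplexOrder InnerProductSpace InnerProduct

noncomputable section

namespace QuantumEstimation

universe u

section TraceClass

variable {H : Type u} [NormedAddCommGroup H] [InnerProductSpace ℂ H] [CompleteSpace H]

/-- The index set of a fixed Hilbert basis of `H`. -/
def basisIndex (H : Type u) [NormedAddCommGroup H] [InnerProductSpace ℂ H] [CompleteSpace H] :
    Set H :=
  (exists_hilbertBasis ℂ H).choose

/-- A fixed Hilbert basis (complete orthonormal system) of `H`. -/
def stdBasis (H : Type u) [NormedAddCommGroup H] [InnerProductSpace ℂ H] [CompleteSpace H] :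
    HilbertBasis (basisIndex H) ℂ H :=
  (exists_hilbertBasis ℂ H).choose_spec.choose

/-- `T` is of trace class: `Tr √(T* T) = ∑ᵢ ⟨eᵢ, |T| eᵢ⟩ < ∞`. -/
def IsTraceClass (T : H →L[ℂ] H) : Prop :=
  Summable fun i => (⟪stdBasis H i, CFC.abs T (stdBasis H i)⟫_ℂ).re

/-- The trace `Tr T = ∑ᵢ ⟨eᵢ, T eᵢ⟩`, meaningful for trace-class `T`. -/
def trace (T : H →L[ℂ] H) : ℂ :=
  ∑' i, ⟪stdBasis H i, T (stdBasis H i)⟫_ℂ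

/-- Auxiliary: `T = ∑ₙ |xₙ⟩⟨yₙ|` with square-summable `‖xₙ‖`, `‖yₙ‖`. -/
def HasFactor {ι : Type u} (T : H →L[ℂ] H) (x y : ι → H) : Prop :=
  (Summable fun n => ‖x n‖ ^ 2) ∧ (Summable fun n => ‖y n‖ ^ 2) ∧
    ∀ v w : H, HasSum (fun n => ⟪v, x n⟫_ℂ * ⟪y n, w⟫_ℂ) ⟪v, T w⟫_ℂ

lemma parseval {H : Type u} [NormedAddCommGroup H] [InnerProductSpace ℂ H] {ι : Type u} (b : HilbertBasis ι ℂ H) (x : H) :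
    HasSum (fun i => ‖⟪b i, x⟫_ℂ‖ ^ 2) (‖x‖ ^ 2) := by
  have h := b.hasSum_inner_mul_inner x x
  have h2 := Complex.hasSum_re h
  have e : (⟪x, x⟫_ℂ).re = ‖x‖ ^ 2 := by
    simpa using inner_self_eq_norm_sq (𝕜 := ℂ) x
  rw [e] at h2
  convert h2 using 2 with i
  rw [← inner_conj_symm x (b i), mul_comm, Complex.mul_conj, Complex.normSq_eq_norm_sq,
    Complex.ofReal_re]

lemma HasFactor.hasSum_trace {ι κ : Type u} {T : H →L[ℂ] H} {x y : ι → H} (h : HasFactor T x y)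
    (b : HilbertBasis κ ℂ H) :
    HasSum (fun i => ⟪b i, T (b i)⟫_ℂ) (∑' n, ⟪y n, x n⟫_ℂ) := by
  obtain ⟨hx, hy, hT⟩ := h
  have key : ∀ z : ι → H, (Summable fun n => ‖z n‖ ^ 2) →
      Summable fun p : ι × κ => ‖⟪b p.2, z p.1⟫_ℂ‖ ^ 2 := by
    intro z hz
    rw [summable_prod_of_nonneg (fun _ => by positivity)]
    refine ⟨fun n => (parseval b (z n)).summable, ?_⟩
    simpa only [(parseval b (z _)).tsum_eq] using hz
  have hs : Summable fun p : ι × κ => ⟪b p.2, x p.1⟫_ℂ * ⟪y p.1, b p.2⟫_ℂ := by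
    refine Summable.of_norm_bounded ((key x hx).add (key y hy)) fun p => ?_
    rw [norm_mul, norm_inner_symm (y p.1)]
    nlinarith [sq_nonneg (‖⟪b p.2, x p.1⟫_ℂ‖ - ‖⟪b p.2, y p.1⟫_ℂ‖),
      sq_nonneg (‖⟪b p.2, x p.1⟫_ℂ‖), sq_nonneg (‖⟪b p.2, y p.1⟫_ℂ‖)]
  have h1 : ∀ n, HasSum (fun i => ⟪b i, x n⟫_ℂ * ⟪y n, b i⟫_ℂ) ⟪y n, x n⟫_ℂ := fun n => by
    simpa only [mul_comm] using b.hasSum_inner_mul_inner (y n) (x n)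
  have h2 := hs.hasSum.prod_fiberwise h1
  have h3 : HasSum (fun q : κ × ι => ⟪b q.1, x q.2⟫_ℂ * ⟪y q.2, b q.1⟫_ℂ)
      (∑' p : ι × κ, ⟪b p.2, x p.1⟫_ℂ * ⟪y p.1, b p.2⟫_ℂ) :=
    (Equiv.prodComm κ ι).hasSum_iff.mpr hs.hasSum
  rw [h2.tsum_eq]
  exact h3.prod_fiberwise fun i => hT (b i) (b i)

lemma HasFactor.mul_left {ι : Type u} {T : H →L[ℂ] H} {x y : ι → H} (h : HasFactor T x y)
    (B : H →L[ℂ] H) : HasFactor (B * T) (fun n => B (x n)) y := by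
  obtain ⟨hx, hy, hT⟩ := h
  refine ⟨?_, hy, fun v w => ?_⟩
  · refine Summable.of_nonneg_of_le (fun _ => by positivity) (fun n => ?_) (hx.mul_left (‖B‖ ^ 2))
    rw [← mul_pow]
    exact pow_le_pow_left₀ (norm_nonneg _) (B.le_opNorm _) 2
  · simpa [← ContinuousLinearMap.adjoint_inner_left] using hT ((B†) v) w

lemma HasFactor.mul_right {ι : Type u} {T : H →L[ℂ] H} {x y : ι → H} (h : HasFactor T x y)
    (B : H →L[ℂ] H) : HasFactor (T * B) x (fun n => (B†) (y n)) := by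
  obtain ⟨hx, hy, hT⟩ := h
  refine ⟨hx, ?_, fun v w => ?_⟩
  · refine Summable.of_nonneg_of_le (fun _ => by positivity) (fun n => ?_)
      (hy.mul_left (‖B†‖ ^ 2))
    rw [← mul_pow]
    exact pow_le_pow_left₀ (norm_nonneg _) ((B†).le_opNorm _) 2
  · simpa [ContinuousLinearMap.adjoint_inner_left] using hT v (B w)

lemma abs_sq_inner (T : H →L[ℂ] H) (v w : H) :
    ⟪CFC.abs T v, CFC.abs T w⟫_ℂ = ⟪T v, T w⟫_ℂ := by
  have h := CFC.abs_mul_abs T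
  have hs : IsSelfAdjoint (CFC.abs T) := (CFC.abs_nonneg T).isSelfAdjoint
  rw [← ContinuousLinearMap.adjoint_inner_right, ← ContinuousLinearMap.adjoint_inner_right T,
    ← ContinuousLinearMap.star_eq_adjoint, ← ContinuousLinearMap.star_eq_adjoint, hs.star_eq]
  have := congrArg (fun S : H →L[ℂ] H => ⟪v, S w⟫_ℂ) h
  simpa using this

lemma norm_abs_apply (T : H →L[ℂ] H) (v : H) : ‖CFC.abs T v‖ = ‖T v‖ := by
  have h := abs_sq_inner T v v
  rw [inner_self_eq_norm_sq_to_K, inner_self_eq_norm_sq_to_K] at h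
  have h' : ‖CFC.abs T v‖ ^ 2 = ‖T v‖ ^ 2 := by exact_mod_cast h
  exact (pow_left_inj₀ (norm_nonneg _) (norm_nonneg _) two_ne_zero).mp h'

lemma exists_polar (T : H →L[ℂ] H) :
    ∃ W : H →L[ℂ] H, T = W * CFC.abs T ∧ CFC.abs T = (W†) * T := by
  set P := CFC.abs T with hP
  let K : Submodule ℂ H := (LinearMap.range P.toLinearMap).topologicalClosure
  have hmem : ∀ v, P v ∈ K := fun v => Submodule.le_topologicalClosure _ ⟨v, rfl⟩
  let e : H →ₗ[ℂ] K := P.toLinearMap.codRestrict K hmem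
  have hd : DenseRange e := by
    rw [DenseRange, Subtype.dense_iff]
    intro v hv
    have : ((↑) '' range e : Set H) = (LinearMap.range P.toLinearMap : Set H) := by
      ext z
      simp [e]
    have h2 : v ∈ closure ((↑) '' range e : Set H) := by
      rw [this]
      exact hv
    exact h2
  have : CompleteSpace K :=
    (Submodule.isClosed_topologicalClosure (LinearMap.range P.toLinearMap)).completeSpace_coe
  have hn : ∃ C, ∀ v, ‖T.toLinearMap v‖ ≤ C * ‖e v‖ :=
    ⟨1, fun v => by
      rw [one_mul]
      exact (norm_abs_apply T v).symm.le⟩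
  let V : K →L[ℂ] H := T.toLinearMap.extendOfNorm e
  have hV : ∀ v, V (e v) = T v := T.toLinearMap.extendOfNorm_eq hd hn
  let W : H →L[ℂ] H := V ∘L K.orthogonalProjectionOnto
  have hWP : ∀ v, W (P v) = T v := fun v => by
    have : K.orthogonalProjectionOnto (P v) = e v :=
      K.orthogonalProjectionOnto_mem_subspace_eq_self (e v)
    simp only [W, ContinuousLinearMap.comp_apply, this, hV]
  refine ⟨W, ContinuousLinearMap.ext fun v => (hWP v).symm, ?_⟩
  have hin : ∀ v (k : K), ⟪T v, V k⟫_ℂ = ⟪P v, (k : H)⟫_ℂ := by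
    intro v k
    refine hd.induction_on (p := fun k : K => ⟪T v, V k⟫_ℂ = ⟪P v, (k : H)⟫_ℂ) k ?_ ?_
    · exact isClosed_eq (by fun_prop) (by fun_prop)
    · intro w
      rw [hV]
      exact (abs_sq_inner T v w).symm
  refine ContinuousLinearMap.ext fun v => ext_inner_right ℂ fun w => ?_
  change _ = ⟪(W†) (T v), w⟫_ℂ
  rw [ContinuousLinearMap.adjoint_inner_left]
  simp only [W, ContinuousLinearMap.comp_apply, hin]
  exact (K.inner_orthogonalProjectionOnto_eq_of_mem_left (e v) w).symm

/-- A trace-class operator is a sum of rank-one operators with square-summable factors, and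
conversely. -/
lemma isTraceClass_iff (T : H →L[ℂ] H) :
    IsTraceClass T ↔ ∃ (ι : Type u) (x y : ι → H), HasFactor T x y := by
  obtain ⟨W, hW1, hW2⟩ := exists_polar T
  constructor
  · intro h
    set P := CFC.abs T with hP
    have hP0 : 0 ≤ P := CFC.abs_nonneg T
    set S := CFC.sqrt P with hS
    have hSS : S * S = P := CFC.sqrt_mul_sqrt_self P hP0
    have hSa : S† = S := (CFC.sqrt_nonneg P).isSelfAdjoint.star_eq
    have hsym : ∀ v w, ⟪S v, w⟫_ℂ = ⟪v, S w⟫_ℂ := fun v w => by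
      conv_lhs => rw [← hSa]
      exact ContinuousLinearMap.adjoint_inner_left S w v
    have hsum : Summable fun i => ‖S (stdBasis H i)‖ ^ 2 := by
      refine (summable_congr fun i => ?_).mp h
      rw [← hP, ← hSS]
      change (⟪_, S (S _)⟫_ℂ).re = _
      rw [← hsym]
      simpa using inner_self_eq_norm_sq (𝕜 := ℂ) (S (stdBasis H i))
    refine ⟨basisIndex H, fun i => W (S (stdBasis H i)), fun i => S (stdBasis H i), ?_, hsum, ?_⟩
    · refine Summable.of_nonneg_of_le (fun _ => by positivity) (fun n => ?_)
        (hsum.mul_left (‖W‖ ^ 2))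
      rw [← mul_pow]
      exact pow_le_pow_left₀ (norm_nonneg _) (W.le_opNorm _) 2
    · intro v w
      have := (stdBasis H).hasSum_inner_mul_inner (S ((W†) v)) (S w)
      simp only [hsym, ContinuousLinearMap.adjoint_inner_left] at this
      rw [hW1, ← hSS]
      simpa [← hsym] using this
  · rintro ⟨ι, x, y, h⟩
    have h2 := (h.mul_left (W†)).hasSum_trace (stdBasis H)
    rw [← hW2] at h2
    exact (Complex.hasSum_re h2).summable

lemma IsTraceClass.summable {T : H →L[ℂ] H} (h : IsTraceClass T) :
    Summable fun i => ⟪stdBasis H i, T (stdBasis H i)⟫_ℂ := by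
  obtain ⟨ι, x, y, hf⟩ := (isTraceClass_iff T).mp h
  exact (hf.hasSum_trace _).summable

lemma HasFactor.trace_eq {ι : Type u} {T : H →L[ℂ] H} {x y : ι → H} (h : HasFactor T x y) :
    trace T = ∑' n, ⟪y n, x n⟫_ℂ :=
  (h.hasSum_trace _).tsum_eq

/-- The trace of a trace-class operator does not depend on the Hilbert basis. -/
lemma IsTraceClass.hasSum_trace {T : H →L[ℂ] H} (h : IsTraceClass T) {κ : Type u}
    (b : HilbertBasis κ ℂ H) : HasSum (fun i => ⟪b i, T (b i)⟫_ℂ) (trace T) := by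
  obtain ⟨ι, x, y, hf⟩ := (isTraceClass_iff T).mp h
  rw [hf.trace_eq]
  exact hf.hasSum_trace b

lemma isTraceClass_zero : IsTraceClass (0 : H →L[ℂ] H) := by
  simp [IsTraceClass, summable_zero]

lemma IsTraceClass.add {S T : H →L[ℂ] H} (hS : IsTraceClass S) (hT : IsTraceClass T) :
    IsTraceClass (S + T) := by
  obtain ⟨ι, x, y, hx, hy, hs⟩ := (isTraceClass_iff S).mp hS
  obtain ⟨κ, x', y', hx', hy', ht⟩ := (isTraceClass_iff T).mp hT
  refine (isTraceClass_iff _).mpr ⟨ι ⊕ κ, Sum.elim x x', Sum.elim y y', ?_, ?_, fun v w => ?_⟩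
  · exact (HasSum.sum (f := fun n => ‖Sum.elim x x' n‖ ^ 2) hx.hasSum hx'.hasSum).summable
  · exact (HasSum.sum (f := fun n => ‖Sum.elim y y' n‖ ^ 2) hy.hasSum hy'.hasSum).summable
  · have := HasSum.sum (f := fun n => ⟪v, Sum.elim x x' n⟫_ℂ * ⟪Sum.elim y y' n, w⟫_ℂ)
      (hs v w) (ht v w)
    simpa [inner_add_right] using this

lemma IsTraceClass.mul_left {T : H →L[ℂ] H} (hT : IsTraceClass T) (B : H →L[ℂ] H) :
    IsTraceClass (B * T) := by
  obtain ⟨ι, x, y, h⟩ := (isTraceClass_iff T).mp hT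
  exact (isTraceClass_iff _).mpr ⟨ι, _, _, h.mul_left B⟩

lemma IsTraceClass.mul_right {T : H →L[ℂ] H} (hT : IsTraceClass T) (B : H →L[ℂ] H) :
    IsTraceClass (T * B) := by
  obtain ⟨ι, x, y, h⟩ := (isTraceClass_iff T).mp hT
  exact (isTraceClass_iff _).mpr ⟨ι, _, _, h.mul_right B⟩

lemma IsTraceClass.smul {T : H →L[ℂ] H} (hT : IsTraceClass T) (c : ℝ) :
    IsTraceClass (c • T) := by
  have := hT.mul_left (c • (1 : H →L[ℂ] H))
  simpa using this

lemma trace_add {S T : H →L[ℂ] H} (hS : IsTraceClass S) (hT : IsTraceClass T) :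
    trace (S + T) = trace S + trace T := by
  simp only [trace, add_apply, inner_add_right]
  exact hS.summable.tsum_add hT.summable

lemma trace_smul (c : ℝ) (T : H →L[ℂ] H) : trace (c • T) = (c : ℂ) * trace T := by
  simp only [trace, ← tsum_mul_left]
  refine tsum_congr fun i => ?_
  rw [smul_apply, ← Complex.coe_smul, inner_smul_right]

end TraceClass

section States

variable {H : Type u} [NormedAddCommGroup H] [InnerProductSpace ℂ H] [CompleteSpace H]

/-- Density operators: positive trace-class operators of trace one. -/
structure DensityOperator (H : Type u) [NormedAddCommGroup H] [InnerProductSpace ℂ H]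
    [CompleteSpace H] where
  op : H →L[ℂ] H
  isPositive : op.IsPositive
  isTraceClass : IsTraceClass op
  trace_eq_one : trace op = 1

/-- The real vector space of self-adjoint trace-class operators of trace zero. -/
def tracelessSelfAdjoint (H : Type u) [NormedAddCommGroup H] [InnerProductSpace ℂ H]
    [CompleteSpace H] : Submodule ℝ (H →L[ℂ] H) where
  carrier := {T | IsTraceClass T ∧ IsSelfAdjoint T ∧ trace T = 0}
  add_mem' := by
    rintro S T ⟨hS, hS', hS0⟩ ⟨hT, hT', hT0⟩
    exact ⟨hS.add hT, hS'.add hT', by rw [trace_add hS hT, hS0, hT0, add_zero]⟩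
  zero_mem' := ⟨isTraceClass_zero, IsSelfAdjoint.zero _, by simp [trace]⟩
  smul_mem' := by
    rintro c T ⟨hT, hT', hT0⟩
    exact ⟨hT.smul c, (IsSelfAdjoint.all c).smul hT', by rw [trace_smul, hT0, mul_zero]⟩

/-- The space `Ξ` of self-adjoint trace-class operators of trace zero. It is a type of its own
because it carries the Hilbert-Schmidt norm and not the operator norm. -/
def Xi (H : Type u) [NormedAddCommGroup H] [InnerProductSpace ℂ H] [CompleteSpace H] : Type u :=
  ↥(tracelessSelfAdjoint H)

instance : AddCommGroup (Xi H) := inferInstanceAs (AddCommGroup ↥(tracelessSelfAdjoint H))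

instance : Module ℝ (Xi H) := inferInstanceAs (Module ℝ ↥(tracelessSelfAdjoint H))

/-- The operator underlying an element of `Ξ`. -/
def Xi.op (φ : Xi H) : H →L[ℂ] H := Subtype.val φ

lemma Xi.isTraceClass (φ : Xi H) : IsTraceClass φ.op := φ.2.1

lemma Xi.isSelfAdjoint (φ : Xi H) : IsSelfAdjoint φ.op := φ.2.2.1

lemma Xi.trace_op (φ : Xi H) : trace φ.op = 0 := φ.2.2.2

lemma Xi.inner_op (φ : Xi H) (v w : H) : ⟪φ.op v, w⟫_ℂ = ⟪v, φ.op w⟫_ℂ := by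
  have h : (φ.op)† = φ.op := φ.isSelfAdjoint.star_eq
  conv_lhs => rw [← h]
  exact ContinuousLinearMap.adjoint_inner_left _ _ _

/-- The Hilbert-Schmidt inner product `(φ, χ) = Tr[φ* χ]` on `Ξ`; it is real there. -/
@[reducible]
def xiCore (H : Type u) [NormedAddCommGroup H] [InnerProductSpace ℂ H] [CompleteSpace H] :
    InnerProductSpace.Core ℝ (Xi H) where
  inner φ χ := (trace ((φ.op†) * χ.op)).re
  conj_inner_symm φ χ := by
    have hφ : (φ.op)† = φ.op := φ.isSelfAdjoint.star_eq
    have hχ : (χ.op)† = χ.op := χ.isSelfAdjoint.star_eq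
    simp only [hφ, hχ, conj_trivial]
    rw [trace, trace, Complex.re_tsum (χ.isTraceClass.mul_right φ.op).summable,
      Complex.re_tsum (φ.isTraceClass.mul_right χ.op).summable]
    refine tsum_congr fun i => ?_
    change (⟪_, χ.op (φ.op _)⟫_ℂ).re = (⟪_, φ.op (χ.op _)⟫_ℂ).re
    rw [← Xi.inner_op, ← Xi.inner_op, ← inner_conj_symm, Complex.conj_re]
  re_inner_nonneg φ := by
    have hφ : (φ.op)† = φ.op := φ.isSelfAdjoint.star_eq
    simp only [hφ, RCLike.re_to_real]
    rw [trace, Complex.re_tsum (φ.isTraceClass.mul_right φ.op).summable]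
    refine tsum_nonneg fun i => ?_
    change 0 ≤ (⟪_, φ.op (φ.op _)⟫_ℂ).re
    rw [← Xi.inner_op]
    exact inner_self_nonneg (𝕜 := ℂ)
  add_left φ χ ψ := by
    have e : ((φ + χ).op†) * ψ.op = (φ.op†) * ψ.op + (χ.op†) * ψ.op := by
      change ((φ.op + χ.op)†) * ψ.op = _
      rw [map_add, add_mul]
    rw [e, trace_add (ψ.isTraceClass.mul_left _) (ψ.isTraceClass.mul_left _), Complex.add_re]
  smul_left φ χ r := by
    have e : ((r • φ).op†) * χ.op = r • ((φ.op†) * χ.op) := by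
      have hφ : (φ.op)† = φ.op := φ.isSelfAdjoint.star_eq
      have hr : ((r • φ).op)† = r • φ.op := (r • φ).isSelfAdjoint.star_eq
      rw [hφ, hr, smul_mul_assoc]
    rw [e, trace_smul, Complex.re_ofReal_mul, conj_trivial]
  definite φ h := by
    have hφ : (φ.op)† = φ.op := φ.isSelfAdjoint.star_eq
    simp only [hφ] at h
    have hs := (φ.isTraceClass.mul_right φ.op).summable
    rw [trace, Complex.re_tsum hs] at h
    have e : ∀ i, (⟪stdBasis H i, (φ.op * φ.op) (stdBasis H i)⟫_ℂ).re
        = ‖φ.op (stdBasis H i)‖ ^ 2 := fun i => by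
      change (⟪_, φ.op (φ.op _)⟫_ℂ).re = _
      rw [← Xi.inner_op]
      simpa using inner_self_eq_norm_sq (𝕜 := ℂ) (φ.op (stdBasis H i))
    have hs' := (Complex.hasSum_re hs.hasSum).summable
    simp only [e] at h hs'
    have h0 := (hasSum_zero_iff_of_nonneg (fun i => by positivity)).mp (h ▸ hs'.hasSum)
    have hz : ∀ i, φ.op (stdBasis H i) = 0 := fun i => by
      have := congrFun h0 i
      simpa using this
    refine Subtype.ext (ContinuousLinearMap.ext fun v => ?_)
    change φ.op v = 0
    have hv := ((stdBasis H).hasSum_repr v).mapL φ.op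
    simp only [map_smul, hz, smul_zero] at hv
    exact hv.unique hasSum_zero

instance : NormedAddCommGroup (Xi H) := (xiCore H).toNormedAddCommGroup

instance : InnerProductSpace ℝ (Xi H) := InnerProductSpace.ofCore (xiCore H).toCore

/-- The real Hilbert space of parameters: `Ξ` with the Hilbert-Schmidt inner product, completed.
For finite-dimensional `H` nothing is added. For infinite-dimensional `H` the space `Ξ` is not
complete, and gradients are vectors of its completion. -/
abbrev XiHilbert (H : Type u) [NormedAddCommGroup H] [InnerProductSpace ℂ H] [CompleteSpace H] :
    Type u :=
  UniformSpace.Completion (Xi H)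

/-- The affine family `ρ(θ) = ρ₀ + θ`, `θ ∈ Ξ`. -/
def family (ρ₀ : DensityOperator H) (θ : Xi H) : H →L[ℂ] H := ρ₀.op + θ.op

/-- The parameter space `Θ = {θ ∈ Ξ | ρ₀ + θ > 0}` (strict positivity). -/
def parameterSpace (ρ₀ : DensityOperator H) : Set (Xi H) :=
  {θ | ∀ ψ : H, ψ ≠ 0 → 0 < (⟪ψ, family ρ₀ θ ψ⟫_ℂ).re}

/-- For `θ ∈ Θ` the operator `ρ(θ)` is a density operator. -/
def state (ρ₀ : DensityOperator H) (θ : parameterSpace ρ₀) : DensityOperator H where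
  op := family ρ₀ θ.1
  isPositive := by
    rw [ContinuousLinearMap.isPositive_def']
    refine ⟨ρ₀.isPositive.isSelfAdjoint.add θ.1.isSelfAdjoint, fun ψ => ?_⟩
    by_cases h : ψ = 0
    · simp [h, ContinuousLinearMap.reApplyInnerSelf]
    · have := (θ.2 ψ h).le
      rw [ContinuousLinearMap.reApplyInnerSelf, ← inner_conj_symm, RCLike.conj_re]
      exact this
  isTraceClass := ρ₀.isTraceClass.add θ.1.isTraceClass
  trace_eq_one := by
    rw [family, trace_add ρ₀.isTraceClass θ.1.isTraceClass, ρ₀.trace_eq_one, θ.1.trace_op,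
      add_zero]

end States

section Measurements

variable {H : Type u} [NormedAddCommGroup H] [InnerProductSpace ℂ H] [CompleteSpace H]
variable {Ω : Type*} [MeasurableSpace Ω]

/-- Positive operator-valued measures on `Ω`, countably additive in the weak sense. The values on
non-measurable sets play no role. -/
structure POVM (Ω : Type*) [MeasurableSpace Ω] (H : Type u) [NormedAddCommGroup H]
    [InnerProductSpace ℂ H] [CompleteSpace H] where
  val : Set Ω → H →L[ℂ] H
  isPositive : ∀ B, MeasurableSet B → (val B).IsPositive
  val_univ : val univ = 1
  hasSum_iUnion : ∀ B : ℕ → Set Ω, (∀ n, MeasurableSet (B n)) →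
    Pairwise (Function.onFun Disjoint B) →
    ∀ v w : H, HasSum (fun n => ⟪v, val (B n) w⟫_ℂ) ⟪v, val (⋃ n, B n) w⟫_ℂ

lemma exists_sqrt {M : H →L[ℂ] H} (hM : M.IsPositive) :
    ∃ S : H →L[ℂ] H, S† = S ∧ ∀ v w, ⟪v, M w⟫_ℂ = ⟪S v, S w⟫_ℂ := by
  have h0 : 0 ≤ M := (ContinuousLinearMap.nonneg_iff_isPositive M).mpr hM
  have hSa : (CFC.sqrt M)† = CFC.sqrt M := (CFC.sqrt_nonneg M).isSelfAdjoint.star_eq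
  refine ⟨CFC.sqrt M, hSa, fun v w => ?_⟩
  conv_lhs => rw [← CFC.sqrt_mul_sqrt_self M h0]
  change ⟪v, CFC.sqrt M (CFC.sqrt M w)⟫_ℂ = _
  rw [← ContinuousLinearMap.adjoint_inner_left, hSa]

lemma HasFactor.trace_mul {ι : Type u} {ρ M : H →L[ℂ] H} {x y : ι → H} (h : HasFactor ρ x y) :
    trace (ρ * M) = ∑' n, ⟪y n, M (x n)⟫_ℂ := by
  rw [(h.mul_right M).trace_eq]
  simp only [ContinuousLinearMap.adjoint_inner_left]

lemma trace_mul_nonneg {ρ M : H →L[ℂ] H} (hρ : ρ.IsPositive) (hρt : IsTraceClass ρ)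
    (hM : M.IsPositive) : 0 ≤ (trace (ρ * M)).re := by
  obtain ⟨ι, x, y, h⟩ := (isTraceClass_iff ρ).mp hρt
  obtain ⟨S, hSa, hS⟩ := exists_sqrt hM
  have h2 := (h.mul_left S).mul_right S
  have e : trace (ρ * M) = trace (S * ρ * S) := by
    rw [h.trace_mul, h2.trace_eq]
    simp only [hS, hSa]
  rw [e, trace, Complex.re_tsum (h2.hasSum_trace _).summable]
  refine tsum_nonneg fun i => ?_
  change 0 ≤ (⟪_, S (ρ (S _))⟫_ℂ).re
  rw [← ContinuousLinearMap.adjoint_inner_left, hSa]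
  exact hρ.re_inner_nonneg_right _

lemma POVM.hasSum_trace (M : POVM Ω H) {ρ : H →L[ℂ] H} (hρ : IsTraceClass ρ) (B : ℕ → Set Ω)
    (hB : ∀ n, MeasurableSet (B n)) (hd : Pairwise (Function.onFun Disjoint B)) :
    HasSum (fun n => trace (ρ * M.val (B n))) (trace (ρ * M.val (⋃ n, B n))) := by
  obtain ⟨ι, x, y, h⟩ := (isTraceClass_iff ρ).mp hρ
  simp only [h.trace_mul]
  have hx := h.1
  have hy := h.2.1
  have key : ∀ z : ι → H, (Summable fun i => ‖z i‖ ^ 2) →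
      Summable fun p : ι × ℕ => (⟪z p.1, M.val (B p.2) (z p.1)⟫_ℂ).re := by
    intro z hz
    have hnn : 0 ≤ fun p : ι × ℕ => (⟪z p.1, M.val (B p.2) (z p.1)⟫_ℂ).re :=
      fun p => (M.isPositive _ (hB p.2)).re_inner_nonneg_right _
    rw [summable_prod_of_nonneg hnn]
    have hk := fun i => Complex.hasSum_re (M.hasSum_iUnion B hB hd (z i) (z i))
    refine ⟨fun i => (hk i).summable, ?_⟩
    simp only [fun i => (hk i).tsum_eq]
    refine Summable.of_nonneg_of_le
      (fun i => (M.isPositive _ (MeasurableSet.iUnion hB)).re_inner_nonneg_right _)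
      (fun i => ?_) (hz.mul_left ‖M.val (⋃ n, B n)‖)
    calc _ ≤ ‖⟪z i, M.val (⋃ n, B n) (z i)⟫_ℂ‖ := Complex.re_le_norm _
      _ ≤ ‖z i‖ * ‖M.val (⋃ n, B n) (z i)‖ := norm_inner_le_norm _ _
      _ ≤ ‖z i‖ * (‖M.val (⋃ n, B n)‖ * ‖z i‖) := by
        gcongr
        exact ContinuousLinearMap.le_opNorm _ _
      _ = _ := by ring
  have hs : Summable fun p : ι × ℕ => ⟪y p.1, M.val (B p.2) (x p.1)⟫_ℂ := by
    refine Summable.of_norm_bounded ((key x hx).add (key y hy)) fun p => ?_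
    obtain ⟨S, -, hS⟩ := exists_sqrt (M.isPositive _ (hB p.2))
    have hn : ∀ v : H, (⟪S v, S v⟫_ℂ).re = ‖S v‖ ^ 2 := fun v => by
      simpa using inner_self_eq_norm_sq (𝕜 := ℂ) (S v)
    simp only [hS, hn]
    have := norm_inner_le_norm (𝕜 := ℂ) (S (y p.1)) (S (x p.1))
    nlinarith [sq_nonneg (‖S (y p.1)‖ - ‖S (x p.1)‖), sq_nonneg ‖S (y p.1)‖,
      sq_nonneg ‖S (x p.1)‖]
  have h2 := hs.hasSum.prod_fiberwise fun i => M.hasSum_iUnion B hB hd (y i) (x i)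
  have h3 : HasSum (fun q : ℕ × ι => ⟪y q.2, M.val (B q.1) (x q.2)⟫_ℂ)
      (∑' p : ι × ℕ, ⟪y p.1, M.val (B p.2) (x p.1)⟫_ℂ) :=
    (Equiv.prodComm ℕ ι).hasSum_iff.mpr hs.hasSum
  rw [h2.tsum_eq]
  exact h3.prod_fiberwise fun n => (h3.summable.prod_factor n).hasSum

/-- The outcome distribution `P(B) = Tr[ρ M(B)]` of the measurement `M` in the state `ρ`. -/
def outcomeMeasure (M : POVM Ω H) (ρ : DensityOperator H) : Measure Ω :=
  Measure.ofMeasurable (fun B _ => ENNReal.ofReal (trace (ρ.op * M.val B)).re)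
    (by
      have h := M.hasSum_trace ρ.isTraceClass (fun _ => ∅) (fun _ => MeasurableSet.empty)
        (fun _ _ _ => disjoint_bot_left)
      have h0 : trace (ρ.op * M.val ∅) = 0 := by
        simpa using tendsto_nhds_unique (tendsto_const_nhds) h.summable.tendsto_atTop_zero
      simp [h0])
    (by
      intro B hB hd
      have h := Complex.hasSum_re (M.hasSum_trace ρ.isTraceClass B hB hd)
      rw [← h.tsum_eq]
      exact ENNReal.ofReal_tsum_of_nonneg
        (fun n => trace_mul_nonneg ρ.isPositive ρ.isTraceClass (M.isPositive _ (hB n)))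
        h.summable)

lemma outcomeMeasure_apply (M : POVM Ω H) (ρ : DensityOperator H) {B : Set Ω}
    (hB : MeasurableSet B) :
    outcomeMeasure M ρ B = ENNReal.ofReal (trace (ρ.op * M.val B)).re :=
  Measure.ofMeasurable_apply B hB

/-- `κ` is the logarithmic gradient at `θ` of the family of outcome distributions
`P_θ(B) = Tr[ρ(θ) M(B)]`, and `‖κ‖` is square integrable: for every event `B` the function
`θ ↦ P_θ(B)` is Fréchet differentiable, and its derivative in the direction `φ` is
`∫_B (κ(x), φ) P_θ(dx)`. In other words, `x ↦ (κ(x), φ)` is the Radon-Nikodym derivative with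
respect to `P_θ` of the derivative of `P_θ` in the direction `φ`. -/
def IsLogGradient (M : POVM Ω H) (ρ₀ : DensityOperator H) (θ : parameterSpace ρ₀)
    (κ : Ω → XiHilbert H) : Prop :=
  MemLp κ 2 (outcomeMeasure M (state ρ₀ θ)) ∧
    ∀ B, MeasurableSet B → ∃ D : Xi H →L[ℝ] ℝ,
      HasFDerivAt (fun θ' : Xi H => (trace (family ρ₀ θ' * M.val B)).re) D θ ∧
      ∀ φ : Xi H, D φ = ∫ x in B, ⟪κ x, (φ : XiHilbert H)⟫_ℝ ∂outcomeMeasure M (state ρ₀ θ)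

/-- The Fisher information operator `J = E[κ κ*]`. -/
def fisherOperator (P : Measure Ω) (κ : Ω → XiHilbert H) : XiHilbert H →L[ℝ] XiHilbert H :=
  ∫ x, InnerProductSpace.rankOne ℝ (κ x) (κ x) ∂P

/-- `S` is a Moore-Penrose inverse of the everywhere defined operator `J`: the four Penrose
equations `J S J = J`, `S J S = S`, `(J S)* = J S`, `(S J)* = S J`. The linear operator `S` may be
unbounded, with a domain that contains the range of `J`; an everywhere defined `S` is the case
`S.domain = ⊤`. -/
def IsMoorePenroseInverse {E : Type*} [NormedAddCommGroup E] [InnerProductSpace ℝ E]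
    (J : E →L[ℝ] E) (S : E →ₗ.[ℝ] E) : Prop :=
  ∃ hJ : ∀ x, J x ∈ S.domain,
    (∀ x, J (S ⟨J x, hJ x⟩) = J x) ∧
    (∀ y : S.domain, S ⟨J (S y), hJ (S y)⟩ = S y) ∧
    (∀ y z : S.domain, ⟪J (S y), (z : E)⟫_ℝ = ⟪(y : E), J (S z)⟫_ℝ) ∧
    (∀ x z : E, ⟪S ⟨J x, hJ x⟩, z⟫_ℝ = ⟪x, S ⟨J z, hJ z⟩⟫_ℝ)

end Measurements

section Observables

variable {H : Type u} [NormedAddCommGroup H] [InnerProductSpace ℂ H] [CompleteSpace H]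

/-- The product `A B` of two possibly unbounded operators, with domain
`{ψ ∈ dom B | B ψ ∈ dom A}`. -/
def opMul (A B : H →ₗ.[ℂ] H) : H →ₗ.[ℂ] H :=
  A.comp (B.domRestrict ((A.domain.comap B.toFun).map B.domain.subtype)) (by
    rintro ⟨ψ, hψ⟩
    obtain ⟨⟨χ, hχ⟩, h1, h2⟩ := hψ.1
    simp only [Submodule.subtype_apply] at h2
    subst h2
    exact h1)

/-- `T` is a trace-class operator that extends `σ X`. -/
def IsTraceClassProduct (σ : H →L[ℂ] H) (X : H →ₗ.[ℂ] H) (T : H →L[ℂ] H) : Prop :=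
  IsTraceClass T ∧ ∀ ψ : X.domain, T ψ = σ (X ψ)

/-- The densely defined operators `X` with `σ X` of trace class, that is, those with a finite
expectation value in the state `σ`. -/
def finiteExpectation (σ : H →L[ℂ] H) : Set (H →ₗ.[ℂ] H) :=
  {X | Dense (X.domain : Set H) ∧ ∃ T, IsTraceClassProduct σ X T}

/-- The self-adjoint operators with a finite expectation value in the state `σ`. -/
def observables (σ : H →L[ℂ] H) : Set (H →ₗ.[ℂ] H) :=
  {A | IsSelfAdjoint A ∧ A ∈ finiteExpectation σ}

open Classical in
/-- The expectation value `Tr[σ X]`. -/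
def expectation (σ : H →L[ℂ] H) (X : H →ₗ.[ℂ] H) : ℂ :=
  if h : X ∈ finiteExpectation σ then trace h.2.choose else 0

/-- The correlation `⟨A B⟩ - ⟨A⟩ ⟨B⟩` of self-adjoint operators. -/
def correlation (σ : H →L[ℂ] H) (A B : H →ₗ.[ℂ] H) : ℂ :=
  expectation σ (opMul A B) - expectation σ A * expectation σ B

/-- The symmetrized correlation, which is real for observables. -/
def symCorrelation (σ : H →L[ℂ] H) (A B : H →ₗ.[ℂ] H) : ℝ :=
  ((1 / 2 : ℂ) * (correlation σ A B + correlation σ B A)).re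

/-- The variance `⟨A²⟩ - ⟨A⟩²`, which is real for observables. -/
def variance (σ : H →L[ℂ] H) (A : H →ₗ.[ℂ] H) : ℝ :=
  (correlation σ A A).re

/-- The commutator `A B - B A`. -/
def opCommutator (A B : H →ₗ.[ℂ] H) : H →ₗ.[ℂ] H := opMul A B - opMul B A

/-- `g` is the gradient at `θ` of `θ ↦ ⟨A⟩_θ = Tr[ρ(θ) A]`: the Fréchet derivative, along the
parameters for which the expectation value is finite, is `φ ↦ (g, φ)`. -/
def IsExpectationGradient (ρ₀ : DensityOperator H) (θ : Xi H) (A : H →ₗ.[ℂ] H)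
    (g : XiHilbert H) : Prop :=
  HasFDerivWithinAt (fun θ' : Xi H => (expectation (family ρ₀ θ') A).re)
    ((innerSL ℝ g).comp (UniformSpace.Completion.toComplL : Xi H →L[ℝ] XiHilbert H))
    {θ' : Xi H | A ∈ finiteExpectation (family ρ₀ θ')} θ

open Classical in
/-- The measurement error of `A`, for a measurement with Fisher information operator `J`, where
`S` is the Moore-Penrose inverse of `J` and `g` is the gradient of the expectation value of `A`:
`(g, S g) - σ²(A)` if `g` is orthogonal to `ker J`, and `+∞` otherwise. -/
def measurementError (σ : H →L[ℂ] H) (A : H →ₗ.[ℂ] H) (J : XiHilbert H →L[ℝ] XiHilbert H)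
    (S : XiHilbert H →ₗ.[ℝ] XiHilbert H) (g : S.domain) : EReal :=
  if (g : XiHilbert H) ∈ (LinearMap.ker J.toLinearMap)ᗮ then
    ((⟪(g : XiHilbert H), S g⟫_ℝ - variance σ A : ℝ) : EReal)
  else ⊤

/-- The quantity `(∇⟨A⟩, S ∇⟨B⟩) - C^S(A, B)`, with `S` the Moore-Penrose inverse of the Fisher
information operator. -/
def residualCorrelation (σ : H →L[ℂ] H) (A B : H →ₗ.[ℂ] H) (S : XiHilbert H →ₗ.[ℝ] XiHilbert H)
    (gA gB : S.domain) : ℝ :=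
  ⟪(gA : XiHilbert H), S gB⟫_ℝ - symCorrelation σ A B

open Classical in
/-- The product of two errors. A product with an infinite factor is infinite, also when the other
factor is zero. -/
def errorMul (a b : EReal) : EReal := if a = ⊤ ∨ b = ⊤ then ⊤ else a * b

end Observables

end QuantumEstimation

end

open QuantumEstimation

/-!
Differentiating `⟨A⟩` at the state `ρ` along the traceless part of `|u⟩⟨w| + |w⟩⟨u|` gives
`2 Re ⟨A u, w⟩` up to a multiple of the overlap of `u` and `w`, while the direction has norm
`O(‖u‖ ‖w‖)`. An observable with a gradient of finite norm is therefore bounded.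

Let `f` be a complex estimator which is unbiased to first order for the bounded operator `F`. The
operator `T = ρ F*` is a complex combination of `ρ` and of two tangent directions, so unbiasedness
yields a function `l`, affine in the logarithmic gradient, with `∫ f l = Tr[T F] = Tr[ρ F* F]`; the
indicator of an event `E` is unbiased for `M(E)`, so that `∫_E l = Tr[ρ F* M(E)]`. On each cell of
a partition `(E_c)`, positivity of `(c̄ - F)* M(E_c) (c̄ - F)` compares `l` with the constant `c`,
and summing over the cells on which a simple function approximating `l` is constant gives
`∫ |l|² ≤ Tr[ρ F* F]`. Hence `2 Tr[ρ F* F] = 2 ∫ f l ≤ ∫ |f|² + ∫ |l|²` implies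
`Tr[ρ F* F] ≤ ∫ |f|²`.

The scores `(κ, J⁺∇⟨A⟩) + ⟨A⟩` and `(κ, J⁺∇⟨B⟩) + ⟨B⟩` are unbiased for `A` and `B`, and so are
their complex combinations for those of `A` and `B`. The resulting Hermitian form on `ℂ²` is thus
positive semidefinite. Its diagonal entries are the two errors, and its off-diagonal entry has real
part `R^M(A, B)` and imaginary part `-Im ⟨AB⟩`, of modulus `|⟨[A, B]⟩| / 2`: the theorem says that
its determinant is nonnegative.
-/

namespace QuantumEstimation

section Trace

variable {H : Type*} [NormedAddCommGroup H] [InnerProductSpace ℂ H]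

open InnerProductSpace in
lemma hasFactor_rankOne (u v : H) :
    HasFactor (rankOne ℂ u v) (fun _ : PUnit => u) (fun _ => v) :=
  ⟨(hasSum_fintype _).summable, (hasSum_fintype _).summable, fun a b => by simp [mul_comm]⟩

variable [CompleteSpace H] {S T : H →L[ℂ] H}

lemma IsTraceClass.smul_complex (hT : IsTraceClass T) (c : ℂ) : IsTraceClass (c • T) := by
  simpa using hT.mul_left (c • (1 : H →L[ℂ] H))

lemma IsTraceClass.sub (hS : IsTraceClass S) (hT : IsTraceClass T) : IsTraceClass (S - T) := by
  simpa [sub_eq_add_neg] using hS.add (hT.smul (-1))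

lemma IsTraceClass.star (hT : IsTraceClass T) : IsTraceClass (star T) := by
  obtain ⟨ι, x, y, hx, hy, h⟩ := (isTraceClass_iff T).mp hT
  refine (isTraceClass_iff _).mpr ⟨ι, y, x, hy, hx, fun v w => ?_⟩
  have hconj := (h w v).map (starRingEnd ℂ) Complex.continuous_conj
  simpa [Function.comp_def, ContinuousLinearMap.star_eq_adjoint,
    ContinuousLinearMap.adjoint_inner_right, mul_comm] using hconj

lemma trace_smul_complex (c : ℂ) (T : H →L[ℂ] H) : trace (c • T) = c * trace T := by
  simp [trace, ← tsum_mul_left]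

lemma trace_sub (hS : IsTraceClass S) (hT : IsTraceClass T) :
    trace (S - T) = trace S - trace T := by
  have h := trace_add hS (hT.smul (-1))
  rw [trace_smul] at h
  simpa [sub_eq_add_neg] using h

lemma trace_mul_comm (hT : IsTraceClass T) (X : H →L[ℂ] H) : trace (T * X) = trace (X * T) := by
  obtain ⟨ι, x, y, h⟩ := (isTraceClass_iff T).mp hT
  rw [h.trace_mul, (h.mul_left X).trace_eq]

lemma trace_star (T : H →L[ℂ] H) : trace (star T) = star (trace T) := by
  rw [trace, trace, ← starRingEnd_apply, Complex.conj_tsum]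
  refine tsum_congr fun i => ?_
  rw [ContinuousLinearMap.star_eq_adjoint, ContinuousLinearMap.adjoint_inner_right,
    inner_conj_symm]

lemma ofReal_re_trace (hT : IsSelfAdjoint T) : ((trace T).re : ℂ) = trace T :=
  Complex.conj_eq_iff_re.mp (by rw [starRingEnd_apply, ← trace_star, hT.star_eq])

lemma trace_mul_star (hT : IsTraceClass T) (hsa : IsSelfAdjoint T) (X : H →L[ℂ] H) :
    trace (T * star X) = star (trace (T * X)) := by
  rw [← trace_star, star_mul, hsa.star_eq, trace_mul_comm hT]

lemma ofReal_re_trace_mul (hT : IsTraceClass T) (hsa : IsSelfAdjoint T) {X : H →L[ℂ] H}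
    (hX : IsSelfAdjoint X) : ((trace (T * X)).re : ℂ) = trace (T * X) :=
  Complex.conj_eq_iff_re.mp (by rw [starRingEnd_apply, ← trace_mul_star hT hsa, hX.star_eq])

/-- The linear functional `X ↦ Tr[T X]` on bounded operators, for a trace-class `T`. -/
noncomputable def IsTraceClass.traceMul (hT : IsTraceClass T) : (H →L[ℂ] H) →ₗ[ℂ] ℂ where
  toFun X := trace (T * X)
  map_add' X Y := by rw [mul_add, trace_add (hT.mul_right X) (hT.mul_right Y)]
  map_smul' c X := by rw [mul_smul_comm, trace_smul_complex, RingHom.id_apply, smul_eq_mul]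

lemma IsTraceClass.traceMul_apply (hT : IsTraceClass T) (X : H →L[ℂ] H) :
    hT.traceMul X = trace (T * X) :=
  rfl

open InnerProductSpace in
lemma isTraceClass_rankOne (u v : H) : IsTraceClass (rankOne ℂ u v) :=
  (isTraceClass_iff _).mpr ⟨_, _, _, hasFactor_rankOne u v⟩

open InnerProductSpace in
lemma trace_rankOne_mul (u v : H) (X : H →L[ℂ] H) : trace (rankOne ℂ u v * X) = ⟪v, X u⟫_ℂ := by
  rw [(hasFactor_rankOne u v).trace_mul]
  simp

open InnerProductSpace in
lemma trace_rankOne (u v : H) : trace (rankOne ℂ u v) = ⟪v, u⟫_ℂ := by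
  simpa using trace_rankOne_mul u v 1

lemma DensityOperator.abs_re_trace_mul_le (ρ : DensityOperator H) {X : H →L[ℂ] H}
    (hX : IsSelfAdjoint X) : |(trace (ρ.op * X)).re| ≤ ‖X‖ := by
  have hbound : ∀ Y : H →L[ℂ] H, IsSelfAdjoint Y → (trace (ρ.op * Y)).re ≤ ‖Y‖ := by
    intro Y hY
    have hpos : (algebraMap ℝ (H →L[ℂ] H) ‖Y‖ - Y).IsPositive :=
      (ContinuousLinearMap.nonneg_iff_isPositive _).mp (sub_nonneg.mpr hY.le_algebraMap_norm_self)
    have h := trace_mul_nonneg ρ.isPositive ρ.isTraceClass hpos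
    rw [Algebra.algebraMap_eq_smul_one, mul_sub, mul_smul_comm, mul_one,
      trace_sub (ρ.isTraceClass.smul _) (ρ.isTraceClass.mul_right _), trace_smul,
      ρ.trace_eq_one] at h
    simpa using h
  refine abs_le.mpr ⟨?_, hbound X hX⟩
  have h := hbound (-X) hX.neg
  rw [norm_neg, ← neg_one_smul ℂ X, mul_smul_comm, trace_smul_complex, neg_one_mul,
    Complex.neg_re] at h
  linarith

end Trace

section Directions

variable {H : Type*} [NormedAddCommGroup H] [InnerProductSpace ℂ H] [CompleteSpace H]

lemma Xi.inner_eq (φ χ : Xi H) : ⟪φ, χ⟫_ℝ = (trace (φ.op * χ.op)).re := by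
  have h : (φ.op)† = φ.op := φ.isSelfAdjoint.star_eq
  change (trace ((φ.op†) * χ.op)).re = _
  rw [h]

lemma family_add_smul (ρ₀ : DensityOperator H) (θ φ : Xi H) (t : ℝ) :
    family ρ₀ (θ + t • φ) = family ρ₀ θ + t • φ.op :=
  (add_assoc ρ₀.op θ.op (t • φ.op)).symm

variable {T : H →L[ℂ] H}

/-- The traceless part `T - Tr[T] ρ` of a self-adjoint trace-class operator `T`, as a direction
in the parameter space `Ξ`. -/
noncomputable def Xi.centered (ρ : DensityOperator H) (hT : IsTraceClass T)
    (hsa : IsSelfAdjoint T) : Xi H :=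
  ⟨T - (trace T).re • ρ.op, hT.sub (ρ.isTraceClass.smul _),
    hsa.sub ((IsSelfAdjoint.all _).smul ρ.isPositive.isSelfAdjoint), by
      rw [trace_sub hT (ρ.isTraceClass.smul _), trace_smul, ρ.trace_eq_one, mul_one,
        ofReal_re_trace hsa, sub_self]⟩

lemma Xi.op_centered (ρ : DensityOperator H) (hT : IsTraceClass T) (hsa : IsSelfAdjoint T) :
    (Xi.centered ρ hT hsa).op = T - (trace T).re • ρ.op :=
  rfl

open scoped ComplexStarModule in
lemma DensityOperator.exists_eq_add_I_smul_add (ρ : DensityOperator H) (hT : IsTraceClass T) :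
    ∃ φ ψ : Xi H, T = φ.op + Complex.I • ψ.op + trace T • ρ.op := by
  have hre : IsTraceClass (ℜ T : H →L[ℂ] H) := by
    rw [realPart_apply_coe]
    exact (hT.add hT.star).smul _
  have him : IsTraceClass (ℑ T : H →L[ℂ] H) := by
    rw [imaginaryPart_apply_coe]
    exact ((hT.sub hT.star).smul _).smul_complex _
  have hre_sa : IsSelfAdjoint (ℜ T : H →L[ℂ] H) := (ℜ T).2
  have him_sa : IsSelfAdjoint (ℑ T : H →L[ℂ] H) := (ℑ T).2
  refine ⟨Xi.centered ρ hre hre_sa, Xi.centered ρ him him_sa, ?_⟩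
  have htr : trace T = trace (ℜ T : H →L[ℂ] H) + Complex.I * trace (ℑ T : H →L[ℂ] H) := by
    rw [← trace_smul_complex, ← trace_add hre (him.smul_complex _),
      realPart_add_I_smul_imaginaryPart]
  rw [Xi.op_centered, Xi.op_centered, htr, ← Complex.coe_smul, ← Complex.coe_smul,
    ofReal_re_trace hre_sa, ofReal_re_trace him_sa]
  conv_lhs => rw [← realPart_add_I_smul_imaginaryPart T]
  module

end Directions

section LineDerivative

lemma eq_of_hasFDerivWithinAt_of_affine_on_line {E : Type*} [NormedAddCommGroup E]
    [NormedSpace ℝ E] {f : E → ℝ} {D : E →L[ℝ] ℝ} {s : Set E} {x v : E} {b c : ℝ}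
    (hD : HasFDerivWithinAt f D s x) (hs : ∀ t : ℝ, x + t • v ∈ s)
    (hf : ∀ t : ℝ, f (x + t • v) = b + t * c) : D v = c := by
  have hpre : (fun t : ℝ => x + t • v) ⁻¹' s = univ := eq_univ_of_forall hs
  have hline := hD.hasLineDerivWithinAt v
  rw [HasLineDerivWithinAt, hpre, hasDerivWithinAt_univ, funext hf] at hline
  have haffine : HasDerivAt (fun t : ℝ => b + t * c) c 0 := by
    simpa using ((hasDerivAt_id (0 : ℝ)).mul_const c).const_add b
  exact hline.unique haffine

end LineDerivative

section UnboundedOperators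

variable {H : Type*} [NormedAddCommGroup H] [InnerProductSpace ℂ H]
variable {A : H →ₗ.[ℂ] H}

lemma norm_apply_le_of_abs_re_inner_le (hd : Dense (A.domain : Set H)) {C : ℝ} (hC₀ : 0 ≤ C)
    (hC : ∀ u w : A.domain, |(⟪A u, (w : H)⟫_ℂ).re| ≤ C * (‖u‖ * ‖w‖)) (u : A.domain) :
    ‖A u‖ ≤ C * ‖u‖ := by
  have hall : ∀ w : H, |(⟪A u, w⟫_ℂ).re| ≤ C * (‖u‖ * ‖w‖) := fun w =>
    hd.induction (fun w hw => hC u ⟨w, hw⟩)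
      (isClosed_le (by fun_prop) (by fun_prop) : IsClosed {w : H | _}) w
  have hself : ‖A u‖ * ‖A u‖ ≤ C * ‖u‖ * ‖A u‖ := by
    have h := (le_abs_self _).trans (hall (A u))
    rwa [← RCLike.re_to_complex, inner_self_eq_norm_mul_norm, ← mul_assoc] at h
  rcases (norm_nonneg (A u)).eq_or_lt with h0 | hpos
  · rw [← h0]
    positivity
  · exact le_of_mul_le_mul_right hself hpos

lemma opMul_toPMap (X Y : H →L[ℂ] H) :
    opMul ((X : H →ₗ[ℂ] H).toPMap ⊤) ((Y : H →ₗ[ℂ] H).toPMap ⊤)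
      = ((X * Y : H →L[ℂ] H) : H →ₗ[ℂ] H).toPMap ⊤ :=
  LinearPMap.ext
    (Submodule.eq_top_iff'.mpr fun y => ⟨⟨⟨y, trivial⟩, trivial, rfl⟩, trivial⟩)
    fun _ _ _ => rfl

lemma opCommutator_toPMap (X Y : H →L[ℂ] H) :
    opCommutator ((X : H →ₗ[ℂ] H).toPMap ⊤) ((Y : H →ₗ[ℂ] H).toPMap ⊤)
      = ((X * Y - Y * X : H →L[ℂ] H) : H →ₗ[ℂ] H).toPMap ⊤ := by
  rw [opCommutator, opMul_toPMap, opMul_toPMap]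
  exact LinearPMap.ext (by simp [LinearPMap.sub_domain]) fun _ _ _ => rfl

variable [CompleteSpace H]

lemma isFormalAdjoint_of_isSelfAdjoint (hA : IsSelfAdjoint A) : A.IsFormalAdjoint A := by
  simpa only [LinearPMap.isSelfAdjoint_def.mp hA]
    using LinearPMap.adjoint_isFormalAdjoint hA.dense_domain

lemma exists_isSelfAdjoint_eq_toPMap (hA : IsSelfAdjoint A) {C : ℝ}
    (hC : ∀ ψ : A.domain, ‖A ψ‖ ≤ C * ‖ψ‖) :
    ∃ X : H →L[ℂ] H, IsSelfAdjoint X ∧ A = (X : H →ₗ[ℂ] H).toPMap ⊤ := by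
  have hadj : A.adjoint = A := LinearPMap.isSelfAdjoint_def.mp hA
  have htop : A.domain = ⊤ := by
    refine Submodule.eq_top_iff'.mpr fun y => ?_
    rw [← hadj, LinearPMap.mem_adjoint_domain_iff]
    exact (innerSL ℂ y).continuous.comp (LinearMap.mkContinuous A.toFun C hC).continuous
  have hmem : ∀ ψ : H, ψ ∈ A.domain := fun ψ => htop ▸ Submodule.mem_top
  let X : H →L[ℂ] H := LinearMap.mkContinuous
    (A.toFun ∘ₗ LinearMap.id.codRestrict A.domain hmem) C fun ψ => hC ⟨ψ, hmem ψ⟩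
  refine ⟨X, ?_, LinearPMap.ext htop fun _ _ _ => rfl⟩
  rw [ContinuousLinearMap.isSelfAdjoint_iff_isSymmetric]
  exact fun x y => isFormalAdjoint_of_isSelfAdjoint hA ⟨x, hmem x⟩ ⟨y, hmem y⟩

lemma expectation_eq {σ T : H →L[ℂ] H} (hd : Dense (A.domain : Set H))
    (hT : IsTraceClassProduct σ A T) : expectation σ A = trace T := by
  have h : A ∈ finiteExpectation σ := ⟨hd, T, hT⟩
  have hext : h.2.choose = T := ContinuousLinearMap.ext_on
    (hd.mono (Submodule.subset_span (R := ℂ))) fun ψ hψ =>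
      (h.2.choose_spec.2 ⟨ψ, hψ⟩).trans (hT.2 ⟨ψ, hψ⟩).symm
  rw [expectation, dif_pos h, hext]

lemma expectation_toPMap {σ : H →L[ℂ] H} (hσ : IsTraceClass σ) (X : H →L[ℂ] H) :
    expectation σ ((X : H →ₗ[ℂ] H).toPMap ⊤) = trace (σ * X) :=
  expectation_eq (by simp) ⟨hσ.mul_right X, fun _ => rfl⟩

lemma correlation_toPMap {σ : H →L[ℂ] H} (hσ : IsTraceClass σ) (X Y : H →L[ℂ] H) :
    correlation σ ((X : H →ₗ[ℂ] H).toPMap ⊤) ((Y : H →ₗ[ℂ] H).toPMap ⊤)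
      = trace (σ * (X * Y)) - trace (σ * X) * trace (σ * Y) := by
  simp only [correlation, opMul_toPMap, expectation_toPMap hσ]

end UnboundedOperators

section RankOneSymm

variable {H : Type*} [NormedAddCommGroup H] [InnerProductSpace ℂ H]

open InnerProductSpace

/-- The symmetric operator `|u⟩⟨w| + |w⟩⟨u|` of rank at most two. Moving the state in its direction
tests the sesquilinear form of an observable on the pair `u, w`. -/
noncomputable def rankOneSymm (u w : H) : H →L[ℂ] H := rankOne ℂ u w + rankOne ℂ w u

lemma norm_rankOneSymm_le (u w : H) : ‖rankOneSymm u w‖ ≤ 2 * (‖u‖ * ‖w‖) := by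
  refine (norm_add_le _ _).trans_eq ?_
  rw [norm_rankOne, norm_rankOne]
  ring

variable [CompleteSpace H]

lemma isTraceClass_rankOneSymm (u w : H) : IsTraceClass (rankOneSymm u w) :=
  (isTraceClass_rankOne u w).add (isTraceClass_rankOne w u)

lemma isSelfAdjoint_rankOneSymm (u w : H) : IsSelfAdjoint (rankOneSymm u w) := by
  simp [IsSelfAdjoint, rankOneSymm, ContinuousLinearMap.star_eq_adjoint, add_comm]

lemma abs_re_trace_rankOneSymm_mul_le (u w : H) (X : H →L[ℂ] H) :
    |(trace (rankOneSymm u w * X)).re| ≤ 2 * (‖u‖ * ‖w‖) * ‖X‖ := by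
  have hinner : ∀ a b : H, ‖⟪a, X b⟫_ℂ‖ ≤ ‖a‖ * (‖X‖ * ‖b‖) := fun a b =>
    (norm_inner_le_norm _ _).trans (by gcongr; exact X.le_opNorm b)
  rw [rankOneSymm, add_mul, trace_add ((isTraceClass_rankOne u w).mul_right X)
    ((isTraceClass_rankOne w u).mul_right X), trace_rankOne_mul, trace_rankOne_mul]
  refine (Complex.abs_re_le_norm _).trans ((norm_add_le _ _).trans ?_)
  linarith [hinner w u, hinner u w]

lemma abs_re_trace_rankOneSymm_le (u w : H) :
    |(trace (rankOneSymm u w)).re| ≤ 2 * (‖u‖ * ‖w‖) := by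
  rw [rankOneSymm, trace_add (isTraceClass_rankOne u w) (isTraceClass_rankOne w u), trace_rankOne,
    trace_rankOne]
  refine (Complex.abs_re_le_norm _).trans ((norm_add_le _ _).trans ?_)
  linarith [norm_inner_le_norm (𝕜 := ℂ) u w, norm_inner_le_norm (𝕜 := ℂ) w u, mul_comm ‖u‖ ‖w‖]

end RankOneSymm

section Gradient

variable {H : Type*} [NormedAddCommGroup H] [InnerProductSpace ℂ H] [CompleteSpace H]
variable {ρ₀ : DensityOperator H} {θ : Xi H} {A : H →ₗ.[ℂ] H} {g : XiHilbert H}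

lemma IsExpectationGradient.inner_eq (hg : IsExpectationGradient ρ₀ θ A g)
    (hA : A ∈ finiteExpectation (family ρ₀ θ)) {φ : Xi H} {T : H →L[ℂ] H}
    (hT : IsTraceClassProduct φ.op A T) : ⟪g, (φ : XiHilbert H)⟫_ℝ = (trace T).re := by
  obtain ⟨hd, T₀, hT₀⟩ := hA
  have hprod : ∀ t : ℝ, IsTraceClassProduct (family ρ₀ (θ + t • φ)) A (T₀ + t • T) := fun t =>
    ⟨hT₀.1.add (hT.1.smul t), fun ψ => by simp [family_add_smul, hT₀.2 ψ, hT.2 ψ]⟩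
  refine eq_of_hasFDerivWithinAt_of_affine_on_line (b := (trace T₀).re) (v := φ) hg
    (fun t => ⟨hd, _, hprod t⟩) fun t => ?_
  rw [expectation_eq hd (hprod t), trace_add hT₀.1 (hT.1.smul t), trace_smul, Complex.add_re,
    Complex.re_ofReal_mul]

open InnerProductSpace

lemma isTraceClassProduct_rankOneSymm (hA : IsSelfAdjoint A) (u w : A.domain) :
    IsTraceClassProduct (rankOneSymm (u : H) w) A
      (rankOne ℂ (u : H) (A w) + rankOne ℂ (w : H) (A u)) := by
  have hsymm := isFormalAdjoint_of_isSelfAdjoint hA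
  refine ⟨(isTraceClass_rankOne _ _).add (isTraceClass_rankOne _ _), fun ψ => ?_⟩
  simp [rankOneSymm, hsymm u ψ, hsymm w ψ]

lemma norm_centered_rankOneSymm_le (ρ : DensityOperator H) (u w : H) :
    ‖Xi.centered ρ (isTraceClass_rankOneSymm u w) (isSelfAdjoint_rankOneSymm u w)‖
      ≤ 3 * (1 + ‖ρ.op‖) * (‖u‖ * ‖w‖) := by
  set φ := Xi.centered ρ (isTraceClass_rankOneSymm u w) (isSelfAdjoint_rankOneSymm u w)
  set t := (trace (rankOneSymm u w)).re
  have hop : φ.op = rankOneSymm u w - t • ρ.op := Xi.op_centered ρ _ _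
  have ht_le : |t| ≤ 2 * (‖u‖ * ‖w‖) := abs_re_trace_rankOneSymm_le u w
  have hop_le : ‖φ.op‖ ≤ 2 * (‖u‖ * ‖w‖) * (1 + ‖ρ.op‖) := by
    calc ‖φ.op‖ ≤ ‖rankOneSymm u w‖ + ‖t • ρ.op‖ := hop ▸ norm_sub_le _ _
      _ ≤ 2 * (‖u‖ * ‖w‖) + 2 * (‖u‖ * ‖w‖) * ‖ρ.op‖ := by
        rw [norm_smul, Real.norm_eq_abs]
        gcongr
        exact norm_rankOneSymm_le u w
      _ = 2 * (‖u‖ * ‖w‖) * (1 + ‖ρ.op‖) := by ring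
  have hinner : ‖φ‖ ^ 2
      = (trace (rankOneSymm u w * φ.op)).re - t * (trace (ρ.op * φ.op)).re := by
    rw [← real_inner_self_eq_norm_sq, Xi.inner_eq]
    nth_rw 1 [hop]
    rw [sub_mul, smul_mul_assoc, trace_sub ((isTraceClass_rankOneSymm u w).mul_right _)
      ((ρ.isTraceClass.mul_right _).smul t), trace_smul, Complex.sub_re, Complex.re_ofReal_mul]
  have hsq : ‖φ‖ ^ 2 ≤ 4 * (‖u‖ * ‖w‖) * ‖φ.op‖ := by
    have h1 := (le_abs_self _).trans (abs_re_trace_rankOneSymm_mul_le u w φ.op)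
    have h2 : |t * (trace (ρ.op * φ.op)).re| ≤ 2 * (‖u‖ * ‖w‖) * ‖φ.op‖ := by
      rw [abs_mul]
      gcongr
      exact ρ.abs_re_trace_mul_le φ.isSelfAdjoint
    linarith [neg_le_of_abs_le h2]
  refine (sq_le_sq₀ (norm_nonneg φ) (by positivity)).mp ?_
  calc ‖φ‖ ^ 2 ≤ 4 * (‖u‖ * ‖w‖) * (2 * (‖u‖ * ‖w‖) * (1 + ‖ρ.op‖)) := hsq.trans (by gcongr)
    _ ≤ (3 * (1 + ‖ρ.op‖) * (‖u‖ * ‖w‖)) ^ 2 := by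
      have hgap : 0 ≤ (1 + ‖ρ.op‖) * (1 + 9 * ‖ρ.op‖) * (‖u‖ * ‖w‖) ^ 2 := by positivity
      linarith

lemma IsExpectationGradient.exists_abs_re_inner_le {θ : parameterSpace ρ₀}
    (hg : IsExpectationGradient ρ₀ θ A g) (hA : A ∈ observables (family ρ₀ θ)) :
    ∃ C, 0 ≤ C ∧ ∀ u w : A.domain, |(⟪A u, (w : H)⟫_ℂ).re| ≤ C * (‖u‖ * ‖w‖) := by
  obtain ⟨hsa, hfin⟩ := hA
  obtain ⟨-, T, hT⟩ := id hfin
  let ρ := state ρ₀ θ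
  refine ⟨3 * (1 + ‖ρ.op‖) * ‖g‖ + |(trace T).re|, by positivity, fun u w => ?_⟩
  set φ := Xi.centered ρ (isTraceClass_rankOneSymm (u : H) w) (isSelfAdjoint_rankOneSymm (u : H) w)
  set t := (trace (rankOneSymm (u : H) w)).re
  have hR := isTraceClassProduct_rankOneSymm hsa u w
  have hφ : IsTraceClassProduct φ.op A
      (rankOne ℂ (u : H) (A w) + rankOne ℂ (w : H) (A u) - t • T) :=
    ⟨hR.1.sub (hT.1.smul t), fun ψ => by
      rw [Xi.op_centered, sub_apply, sub_apply, smul_apply, smul_apply, hR.2 ψ, hT.2 ψ]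
      rfl⟩
  have hgrad : ⟪g, (φ : XiHilbert H)⟫_ℝ = 2 * (⟪A u, (w : H)⟫_ℂ).re - t * (trace T).re := by
    have hsymm : (⟪A w, (u : H)⟫_ℂ).re = (⟪A u, (w : H)⟫_ℂ).re := by
      rw [isFormalAdjoint_of_isSelfAdjoint hsa w u, ← inner_conj_symm, Complex.conj_re]
    rw [hg.inner_eq hfin hφ, trace_sub hR.1 (hT.1.smul t), trace_smul,
      trace_add (isTraceClass_rankOne _ _) (isTraceClass_rankOne _ _), trace_rankOne, trace_rankOne,
      Complex.sub_re, Complex.add_re, Complex.re_ofReal_mul, hsymm, two_mul]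
  have hφ_le : |⟪g, (φ : XiHilbert H)⟫_ℝ| ≤ ‖g‖ * (3 * (1 + ‖ρ.op‖) * (‖u‖ * ‖w‖)) := by
    refine (abs_real_inner_le_norm _ _).trans ?_
    rw [UniformSpace.Completion.norm_coe]
    gcongr
    exact norm_centered_rankOneSymm_le ρ (u : H) w
  have ht_le : |t * (trace T).re| ≤ 2 * (‖u‖ * ‖w‖) * |(trace T).re| := by
    rw [abs_mul]
    gcongr
    exact abs_re_trace_rankOneSymm_le (u : H) w
  have hC : 0 ≤ ‖g‖ * (3 * (1 + ‖ρ.op‖) * (‖u‖ * ‖w‖)) := by positivity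
  refine abs_le.mpr ⟨?_, ?_⟩ <;> linarith [abs_le.mp hφ_le, abs_le.mp ht_le]

lemma IsExpectationGradient.exists_bounded {θ : parameterSpace ρ₀}
    (hg : IsExpectationGradient ρ₀ θ A g) (hA : A ∈ observables (family ρ₀ θ)) :
    ∃ X : H →L[ℂ] H, IsSelfAdjoint X ∧ A = (X : H →ₗ[ℂ] H).toPMap ⊤ ∧
      ∀ φ : Xi H, (⟪g, (φ : XiHilbert H)⟫_ℝ : ℂ) = trace (φ.op * X) := by
  obtain ⟨C, hC₀, hC⟩ := hg.exists_abs_re_inner_le hA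
  obtain ⟨X, hX, rfl⟩ := exists_isSelfAdjoint_eq_toPMap hA.1
    (norm_apply_le_of_abs_re_inner_le hA.2.1 hC₀ hC)
  refine ⟨X, hX, rfl, fun φ => ?_⟩
  rw [hg.inner_eq hA.2 ⟨φ.isTraceClass.mul_right X, fun _ => rfl⟩,
    ofReal_re_trace_mul φ.isTraceClass φ.isSelfAdjoint hX]

end Gradient

section MoorePenrose

variable {E : Type*} [NormedAddCommGroup E] [InnerProductSpace ℝ E] {J : E →L[ℝ] E}
  {S : E →ₗ.[ℝ] E}

lemma IsMoorePenroseInverse.apply_apply_of_mem_orthogonal_ker (hS : IsMoorePenroseInverse J S)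
    (hJ : ∀ x y, ⟪J x, y⟫_ℝ = ⟪x, J y⟫_ℝ) {g : S.domain}
    (hg : (g : E) ∈ (LinearMap.ker J.toLinearMap)ᗮ) : J (S g) = g := by
  obtain ⟨hdom, hJSJ, -, hJS_symm, -⟩ := hS
  have hker : J (S g) - g ∈ LinearMap.ker J.toLinearMap := by
    refine LinearMap.mem_ker.mpr (ext_inner_right ℝ fun x => ?_)
    have h := hJS_symm g ⟨J x, hdom x⟩
    simp only [hJSJ] at h
    rw [ContinuousLinearMap.coe_coe, hJ, inner_sub_left, h, sub_self, inner_zero_left]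
  have hker' : J (J (S g) - g) = 0 := hker
  have hself : ⟪J (S g) - g, J (S g) - g⟫_ℝ = 0 := by
    rw [inner_sub_right, ← hJ, hker', inner_zero_left,
      (Submodule.mem_orthogonal _ _).mp hg _ hker, sub_zero]
  exact sub_eq_zero.mp (inner_self_eq_zero.mp hself)

end MoorePenrose

section Integration

variable {Ω : Type*} [MeasurableSpace Ω] {P : Measure Ω}

lemma integral_eq_sum_setIntegral_fiber {E F : Type*} [NormedAddCommGroup F] [NormedSpace ℝ F]
    {f : Ω → F} (hf : Integrable f P) (s : SimpleFunc Ω E) :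
    ∫ x, f x ∂P = ∑ c ∈ s.range, ∫ x in s ⁻¹' {c}, f x ∂P := by
  rw [← integral_biUnion_finset s.range (fun c _ => s.measurableSet_fiber c)
    ((pairwise_disjoint_fiber s).set_pairwise _) fun _ _ => hf.integrableOn,
    ← setIntegral_univ]
  congr
  exact (eq_univ_of_forall fun x => mem_biUnion (s.mem_range_self x) rfl).symm

lemma exists_simpleFunc_integral_norm_sub_sq_lt {E : Type*} [NormedAddCommGroup E] {f : Ω → E}
    (hf : MemLp f 2 P) {ε : ℝ} (hε : 0 < ε) :
    ∃ s : SimpleFunc Ω E, MemLp s 2 P ∧ ∫ x, ‖f x - s x‖ ^ 2 ∂P < ε := by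
  obtain ⟨s, hlt, hs⟩ := hf.exists_simpleFunc_eLpNorm_sub_lt (by simp)
    (ENNReal.ofReal_pos.mpr (Real.sqrt_pos.mpr hε)).ne'
  refine ⟨s, hs, ?_⟩
  have hnorm : ∫ x, ‖f x - s x‖ ^ 2 ∂P = (eLpNorm (f - ⇑s) 2 P).toReal ^ 2 := by
    rw [(hf.sub hs).eLpNorm_eq_integral_rpow_norm two_ne_zero ENNReal.ofNat_ne_top,
      ENNReal.toReal_ofReal (by positivity)]
    have hnonneg : 0 ≤ ∫ x, ‖f x - s x‖ ^ 2 ∂P := integral_nonneg fun x => sq_nonneg _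
    simpa using (Real.rpow_inv_natCast_pow hnonneg two_ne_zero).symm
  rw [hnorm, ← Real.lt_sqrt (by positivity)]
  exact (ENNReal.lt_ofReal_iff_toReal_lt hlt.ne_top).mp hlt

variable {H : Type*} [NormedAddCommGroup H] [InnerProductSpace ℂ H] [CompleteSpace H]
  {κ : Ω → XiHilbert H}

lemma memLp_inner_const (hκ : MemLp κ 2 P) (a : XiHilbert H) :
    MemLp (fun x => (⟪κ x, a⟫_ℝ : ℂ)) 2 P := by
  have h : MemLp (fun x => ((⟪a, κ x⟫_ℝ : ℝ) : ℂ)) 2 P := (hκ.const_inner (𝕜 := ℝ) a).ofReal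
  simpa only [real_inner_comm a] using h

lemma inner_fisherOperator (hκ : MemLp κ 2 P) (a b : XiHilbert H) :
    ⟪fisherOperator P κ a, b⟫_ℝ = ∫ x, ⟪κ x, a⟫_ℝ * ⟪κ x, b⟫_ℝ ∂P := by
  have hint : Integrable (fun x => InnerProductSpace.rankOne ℝ (κ x) (κ x)) P := by
    refine (hκ.integrable_norm_pow two_ne_zero).mono' ?_ (.of_forall fun x => ?_)
    · have hcont : Continuous fun v : XiHilbert H => InnerProductSpace.rankOne ℝ v v :=
        (InnerProductSpace.rankOne ℝ).continuous.clm_apply continuous_id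
      exact hcont.comp_aestronglyMeasurable hκ.1
    · rw [InnerProductSpace.norm_rankOne, sq]
  rw [fisherOperator, ContinuousLinearMap.integral_apply hint, real_inner_comm,
    ← integral_inner (hint.apply_continuousLinearMap a)]
  refine integral_congr_ae (.of_forall fun x => ?_)
  simp [inner_smul_right, real_inner_comm b]

lemma inner_fisherOperator_comm (hκ : MemLp κ 2 P) (a b : XiHilbert H) :
    ⟪fisherOperator P κ a, b⟫_ℝ = ⟪a, fisherOperator P κ b⟫_ℝ := by
  rw [real_inner_comm _ a, inner_fisherOperator hκ, inner_fisherOperator hκ]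
  simp only [mul_comm]

end Integration

section Measurement

variable {H : Type*} [NormedAddCommGroup H] [InnerProductSpace ℂ H] [CompleteSpace H]
variable {Ω : Type*} [MeasurableSpace Ω]

lemma POVM.isSelfAdjoint (M : POVM Ω H) {E : Set Ω} (hE : MeasurableSet E) :
    IsSelfAdjoint (M.val E) :=
  (M.isPositive E hE).isSelfAdjoint

open Classical in
/-- The complex measure `E ↦ ⟨v, M(E) w⟩`. It gives access to the library results on finite
additivity; as every vector measure it vanishes on non-measurable sets. -/
noncomputable def POVM.weakMeasure (M : POVM Ω H) (v w : H) : VectorMeasure Ω ℂ where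
  measureOf' E := if MeasurableSet E then ⟪v, M.val E w⟫_ℂ else 0
  empty' := by
    have h := M.hasSum_iUnion (fun _ => ∅) (fun _ => MeasurableSet.empty)
      (fun _ _ _ => disjoint_bot_left) v w
    simpa using tendsto_nhds_unique tendsto_const_nhds h.summable.tendsto_atTop_zero
  not_measurable' _ hE := if_neg hE
  m_iUnion' E hE hd := by
    simpa only [hE, MeasurableSet.iUnion hE, if_true] using M.hasSum_iUnion E hE hd v w

lemma POVM.weakMeasure_apply (M : POVM Ω H) (v w : H) {E : Set Ω} (hE : MeasurableSet E) :
    M.weakMeasure v w E = ⟪v, M.val E w⟫_ℂ :=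
  if_pos hE

lemma POVM.sum_val_fiber (M : POVM Ω H) {E : Type*} (s : SimpleFunc Ω E) :
    ∑ c ∈ s.range, M.val (s ⁻¹' {c}) = 1 := by
  refine ContinuousLinearMap.ext fun w => ext_inner_left ℂ fun v => ?_
  have hcover : ⋃ c ∈ s.range, s ⁻¹' {c} = univ :=
    eq_univ_of_forall fun x => mem_biUnion (s.mem_range_self x) rfl
  have h := (M.weakMeasure v w).of_biUnion_finset (s := s.range) (f := fun c => s ⁻¹' {c})
    ((pairwise_disjoint_fiber s).set_pairwise _) fun c _ => s.measurableSet_fiber c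
  rw [hcover, M.weakMeasure_apply v w MeasurableSet.univ, M.val_univ] at h
  rw [h, sum_apply, inner_sum]
  exact Finset.sum_congr rfl fun c _ => (M.weakMeasure_apply v w (s.measurableSet_fiber c)).symm

instance (M : POVM Ω H) (ρ : DensityOperator H) : IsProbabilityMeasure (outcomeMeasure M ρ) :=
  ⟨by simp [outcomeMeasure_apply, M.val_univ, ρ.trace_eq_one]⟩

lemma ofReal_real_outcomeMeasure (M : POVM Ω H) (ρ : DensityOperator H) {E : Set Ω}
    (hE : MeasurableSet E) : ((outcomeMeasure M ρ).real E : ℂ) = trace (ρ.op * M.val E) := by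
  rw [measureReal_def, outcomeMeasure_apply M ρ hE,
    ENNReal.toReal_ofReal (trace_mul_nonneg ρ.isPositive ρ.isTraceClass (M.isPositive _ hE)),
    ofReal_re_trace_mul ρ.isTraceClass ρ.isPositive.isSelfAdjoint (M.isSelfAdjoint hE)]

end Measurement

section Contraction

variable {H : Type*} [NormedAddCommGroup H] [InnerProductSpace ℂ H] [CompleteSpace H]

lemma two_mul_re_conj_mul_trace_le {ρ M : H →L[ℂ] H} (hρ : ρ.IsPositive) (hρt : IsTraceClass ρ)
    (hM : M.IsPositive) (X : H →L[ℂ] H) (c : ℂ) :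
    2 * (star c * trace (ρ * (star X * M))).re
      ≤ ‖c‖ ^ 2 * (trace (ρ * M)).re + (trace (ρ * (star X * M * X))).re := by
  have hpos : (star (star c • 1 - X) * M * (star c • 1 - X)).IsPositive := by
    rw [mul_assoc, ContinuousLinearMap.star_eq_adjoint]
    exact hM.adjoint_conj _
  have hexpand : star (star c • 1 - X) * M * (star c • 1 - X)
      = (c * star c) • M - c • star (star X * M) - star c • (star X * M) + star X * M * X := by
    simp only [star_sub, star_smul, star_star, star_one, star_mul, hM.isSelfAdjoint.star_eq,
      sub_mul, mul_sub, smul_mul_assoc, mul_smul_comm, one_mul, mul_one, smul_sub, smul_smul]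
    rw [mul_comm c]
    abel
  have htrace := trace_mul_nonneg hρ hρt hpos
  simp only [hexpand, ← hρt.traceMul_apply, map_add, map_sub, map_smul] at htrace
  simp only [hρt.traceMul_apply, trace_mul_star hρt hρ.isSelfAdjoint, smul_eq_mul] at htrace
  have hconj : (c * star (trace (ρ * (star X * M)))).re
      = (star c * trace (ρ * (star X * M))).re := by
    simp
  have hnorm : c * star c = ((‖c‖ ^ 2 : ℝ) : ℂ) := by
    simpa using Complex.mul_conj' c
  simp only [Complex.add_re, Complex.sub_re, hconj, hnorm, Complex.re_ofReal_mul] at htrace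
  linarith

variable {Ω : Type*} [MeasurableSpace Ω] {M : POVM Ω H} {ρ : DensityOperator H} {X : H →L[ℂ] H}
  {l : Ω → ℂ}

lemma POVM.setIntegral_norm_sq_le (hl : MemLp l 2 (outcomeMeasure M ρ)) {E : Set Ω}
    (hE : MeasurableSet E)
    (hlE : ∫ x in E, l x ∂outcomeMeasure M ρ = trace (ρ.op * (star X * M.val E))) (c : ℂ) :
    ∫ x in E, ‖l x‖ ^ 2 ∂outcomeMeasure M ρ
      ≤ ∫ x in E, ‖l x - c‖ ^ 2 ∂outcomeMeasure M ρ
        + (trace (ρ.op * (star X * M.val E * X))).re := by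
  have hexpand : ∀ z : ℂ, ‖z‖ ^ 2 = ‖z - c‖ ^ 2 + (2 * (star c * z).re - ‖c‖ ^ 2) := fun z => by
    simp only [← Complex.normSq_eq_norm_sq, Complex.normSq_apply]
    simp only [Complex.sub_re, Complex.sub_im, RCLike.star_def, Complex.mul_re, Complex.conj_re,
      Complex.conj_im]
    ring
  have hint : Integrable l (outcomeMeasure M ρ) := hl.integrable one_le_two
  have hre : Integrable (fun x => (star c * l x).re) (outcomeMeasure M ρ) :=
    (hint.const_mul (star c)).re
  have hsub : Integrable (fun x => ‖l x - c‖ ^ 2) (outcomeMeasure M ρ) :=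
    (hl.sub (memLp_const c)).integrable_norm_pow two_ne_zero
  have hlin : Integrable (fun x => 2 * (star c * l x).re - ‖c‖ ^ 2) (outcomeMeasure M ρ) :=
    (hre.const_mul 2).sub (integrable_const _)
  have hcell : ∫ x in E, (2 * (star c * l x).re - ‖c‖ ^ 2) ∂outcomeMeasure M ρ
      = 2 * (star c * trace (ρ.op * (star X * M.val E))).re
        - ‖c‖ ^ 2 * (trace (ρ.op * M.val E)).re := by
    have hswap : ∫ x in E, (star c * l x).re ∂outcomeMeasure M ρ
        = (∫ x in E, star c * l x ∂outcomeMeasure M ρ).re :=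
      integral_re (𝕜 := ℂ) (hint.const_mul (star c)).integrableOn
    rw [integral_sub (hre.const_mul 2).integrableOn (integrable_const _),
      integral_const_mul, setIntegral_const, hswap, integral_const_mul, hlE,
      ← ofReal_real_outcomeMeasure M ρ hE, Complex.ofReal_re, smul_eq_mul, mul_comm (‖c‖ ^ 2)]
  rw [integral_congr_ae (.of_forall fun x => hexpand (l x)),
    integral_add hsub.integrableOn hlin.integrableOn, hcell]
  linarith [two_mul_re_conj_mul_trace_le ρ.isPositive ρ.isTraceClass (M.isPositive E hE) X c]

lemma POVM.integral_norm_sq_le (hl : MemLp l 2 (outcomeMeasure M ρ))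
    (hlE : ∀ E, MeasurableSet E →
      ∫ x in E, l x ∂outcomeMeasure M ρ = trace (ρ.op * (star X * M.val E))) :
    ∫ x, ‖l x‖ ^ 2 ∂outcomeMeasure M ρ ≤ (trace (ρ.op * (star X * X))).re := by
  refine le_of_forall_pos_le_add fun ε hε => ?_
  obtain ⟨s, hs, hlt⟩ := exists_simpleFunc_integral_norm_sub_sq_lt hl hε
  have hsub : Integrable (fun x => ‖l x - s x‖ ^ 2) (outcomeMeasure M ρ) :=
    (hl.sub hs).integrable_norm_pow two_ne_zero
  have htrace : ∑ c ∈ s.range, trace (ρ.op * (star X * M.val (s ⁻¹' {c}) * X))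
      = trace (ρ.op * (star X * X)) := by
    simp only [← ρ.isTraceClass.traceMul_apply]
    rw [← map_sum, ← Finset.sum_mul, ← Finset.mul_sum, M.sum_val_fiber, mul_one]
  calc ∫ x, ‖l x‖ ^ 2 ∂outcomeMeasure M ρ
      = ∑ c ∈ s.range, ∫ x in s ⁻¹' {c}, ‖l x‖ ^ 2 ∂outcomeMeasure M ρ :=
        integral_eq_sum_setIntegral_fiber (hl.integrable_norm_pow two_ne_zero) s
    _ ≤ ∑ c ∈ s.range, (∫ x in s ⁻¹' {c}, ‖l x - s x‖ ^ 2 ∂outcomeMeasure M ρ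
          + (trace (ρ.op * (star X * M.val (s ⁻¹' {c}) * X))).re) := by
        refine Finset.sum_le_sum fun c _ => ?_
        have hE := s.measurableSet_fiber c
        have hs_eq : ∫ x in s ⁻¹' {c}, ‖l x - s x‖ ^ 2 ∂outcomeMeasure M ρ
            = ∫ x in s ⁻¹' {c}, ‖l x - c‖ ^ 2 ∂outcomeMeasure M ρ :=
          setIntegral_congr_fun hE fun x hx => by rw [mem_singleton_iff.mp hx]
        rw [hs_eq]
        exact POVM.setIntegral_norm_sq_le hl hE (hlE _ hE) c
    _ = ∫ x, ‖l x - s x‖ ^ 2 ∂outcomeMeasure M ρ + (trace (ρ.op * (star X * X))).re := by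
        rw [Finset.sum_add_distrib, ← integral_eq_sum_setIntegral_fiber hsub s, ← Complex.re_sum,
          htrace]
    _ ≤ (trace (ρ.op * (star X * X))).re + ε := by linarith

end Contraction

section LocallyUnbiased

variable {H : Type*} [NormedAddCommGroup H] [InnerProductSpace ℂ H] [CompleteSpace H]
variable {Ω : Type*} [MeasurableSpace Ω]

/-- `f` is a square integrable estimator whose mean under the outcome distribution `P` agrees to
first order at the state `ρ` with the expectation value of `F`: the means agree at `ρ`, and so do
their derivatives in all directions `φ`, that of the mean of `f` being expressed through the
logarithmic gradient `κ`. Both `f` and `F` may be complex. -/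
structure IsLocallyUnbiased (P : Measure Ω) (ρ : H →L[ℂ] H) (κ : Ω → XiHilbert H) (f : Ω → ℂ)
    (F : H →L[ℂ] H) : Prop where
  memLp : MemLp f 2 P
  integral_eq : ∫ x, f x ∂P = trace (ρ * F)
  integral_mul_inner_eq (φ : Xi H) :
    ∫ x, f x * (⟪κ x, (φ : XiHilbert H)⟫_ℝ : ℂ) ∂P = trace (φ.op * F)

lemma integral_linearCombination_mul {P : Measure Ω} {f g k : Ω → ℂ} (hf : MemLp f 2 P)
    (hg : MemLp g 2 P) (hk : MemLp k 2 P) (c d : ℂ) :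
    ∫ x, (c * f x + d * g x) * k x ∂P = c * ∫ x, f x * k x ∂P + d * ∫ x, g x * k x ∂P := by
  have hfk : Integrable (fun x => f x * k x) P := hf.integrable_mul hk
  have hgk : Integrable (fun x => g x * k x) P := hg.integrable_mul hk
  simp only [add_mul, mul_assoc]
  rw [integral_add (hfk.const_mul c) (hgk.const_mul d), integral_const_mul, integral_const_mul]

lemma IsLocallyUnbiased.linearCombination {P : Measure Ω} [IsFiniteMeasure P] {ρ : H →L[ℂ] H}
    (hρ : IsTraceClass ρ) {κ : Ω → XiHilbert H} (hκ : MemLp κ 2 P) {f g : Ω → ℂ}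
    {F G : H →L[ℂ] H} (hf : IsLocallyUnbiased P ρ κ f F) (hg : IsLocallyUnbiased P ρ κ g G)
    (c d : ℂ) :
    IsLocallyUnbiased P ρ κ (fun x => c * f x + d * g x) (c • F + d • G) where
  memLp := (hf.memLp.const_mul c).add (hg.memLp.const_mul d)
  integral_eq := by
    have h := integral_linearCombination_mul hf.memLp hg.memLp (memLp_const (1 : ℂ)) c d
    simp only [mul_one, hf.integral_eq, hg.integral_eq] at h
    simp only [h, ← hρ.traceMul_apply, map_add, map_smul, smul_eq_mul]
  integral_mul_inner_eq φ := by
    rw [integral_linearCombination_mul hf.memLp hg.memLp (memLp_inner_const hκ _),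
      hf.integral_mul_inner_eq, hg.integral_mul_inner_eq]
    simp only [← φ.isTraceClass.traceMul_apply, map_add, map_smul, smul_eq_mul]

lemma two_mul_re_integral_mul_le {P : Measure Ω} {f l : Ω → ℂ} (hf : MemLp f 2 P)
    (hl : MemLp l 2 P) :
    2 * (∫ x, f x * l x ∂P).re ≤ ∫ x, ‖f x‖ ^ 2 ∂P + ∫ x, ‖l x‖ ^ 2 ∂P := by
  have hint : Integrable (fun x => f x * l x) P := hf.integrable_mul hl
  have hf_sq := hf.integrable_norm_pow two_ne_zero
  have hl_sq := hl.integrable_norm_pow two_ne_zero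
  have hswap : ∫ x, (f x * l x).re ∂P = (∫ x, f x * l x ∂P).re := integral_re (𝕜 := ℂ) hint
  rw [← hswap, ← integral_const_mul, ← integral_add hf_sq hl_sq]
  refine integral_mono (hint.re.const_mul 2) (hf_sq.add hl_sq) fun x => ?_
  have hre : (f x * l x).re ≤ ‖f x‖ * ‖l x‖ := (Complex.re_le_norm _).trans_eq (norm_mul _ _)
  have hamgm := two_mul_le_add_sq ‖f x‖ ‖l x‖
  simp only
  linarith

variable {M : POVM Ω H} {ρ₀ : DensityOperator H} {θ : parameterSpace ρ₀} {κ : Ω → XiHilbert H}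

lemma IsLogGradient.setIntegral_inner (hκ : IsLogGradient M ρ₀ θ κ) {E : Set Ω}
    (hE : MeasurableSet E) (φ : Xi H) :
    ∫ x in E, ⟪κ x, (φ : XiHilbert H)⟫_ℝ ∂outcomeMeasure M (state ρ₀ θ)
      = (trace (φ.op * M.val E)).re := by
  obtain ⟨D, hD, hDφ⟩ := hκ.2 E hE
  rw [← hDφ]
  refine eq_of_hasFDerivWithinAt_of_affine_on_line (b := (trace (family ρ₀ θ * M.val E)).re)
    (hD.hasFDerivWithinAt (s := univ)) (fun _ => mem_univ _) fun t => ?_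
  have hθ : IsTraceClass (family ρ₀ θ) := (state ρ₀ θ).isTraceClass
  rw [family_add_smul, add_mul, smul_mul_assoc, trace_add (hθ.mul_right _)
    ((φ.isTraceClass.mul_right _).smul t), trace_smul, Complex.add_re, Complex.re_ofReal_mul]

lemma IsLogGradient.isLocallyUnbiased_indicator (hκ : IsLogGradient M ρ₀ θ κ) {E : Set Ω}
    (hE : MeasurableSet E) :
    IsLocallyUnbiased (outcomeMeasure M (state ρ₀ θ)) (family ρ₀ θ) κ (E.indicator 1)
      (M.val E) where
  memLp := (memLp_const (1 : ℂ)).indicator hE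
  integral_eq := by
    rw [integral_indicator hE]
    simp only [Pi.one_apply, setIntegral_const, Complex.real_smul, mul_one]
    exact ofReal_real_outcomeMeasure M (state ρ₀ θ) hE
  integral_mul_inner_eq φ := by
    have hind : ∀ x, E.indicator (1 : Ω → ℂ) x * (⟪κ x, (φ : XiHilbert H)⟫_ℝ : ℂ)
        = E.indicator (fun x => (⟪κ x, (φ : XiHilbert H)⟫_ℝ : ℂ)) x := fun x => by
      by_cases hx : x ∈ E <;> simp [hx]
    simp only [hind]
    rw [integral_indicator hE, integral_complex_ofReal, hκ.setIntegral_inner hE,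
      ofReal_re_trace_mul φ.isTraceClass φ.isSelfAdjoint (M.isSelfAdjoint hE)]

lemma IsLogGradient.exists_density (hκ : IsLogGradient M ρ₀ θ κ) {T : H →L[ℂ] H}
    (hT : IsTraceClass T) :
    ∃ l : Ω → ℂ, MemLp l 2 (outcomeMeasure M (state ρ₀ θ)) ∧
      ∀ f F, IsLocallyUnbiased (outcomeMeasure M (state ρ₀ θ)) (family ρ₀ θ) κ f F →
        ∫ x, f x * l x ∂outcomeMeasure M (state ρ₀ θ) = trace (T * F) := by
  set P := outcomeMeasure M (state ρ₀ θ)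
  obtain ⟨φ, ψ, hdecomp⟩ := (state ρ₀ θ).exists_eq_add_I_smul_add hT
  have hφ := memLp_inner_const hκ.1 (φ : XiHilbert H)
  have hψ := memLp_inner_const hκ.1 (ψ : XiHilbert H)
  have hT₀ : MemLp (fun _ => trace T) 2 P := memLp_const _
  refine ⟨_, (hφ.add (hψ.const_mul Complex.I)).add hT₀, fun f F hf => ?_⟩
  have htrace : trace (T * F)
      = trace (φ.op * F) + Complex.I * trace (ψ.op * F) + trace T * trace (family ρ₀ θ * F) := by
    have hφF := φ.isTraceClass.mul_right F
    have hψF := (ψ.isTraceClass.mul_right F).smul_complex Complex.I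
    have hρF := ((state ρ₀ θ).isTraceClass.mul_right F).smul_complex (trace T)
    nth_rw 1 [hdecomp]
    rw [add_mul, add_mul, smul_mul_assoc, smul_mul_assoc, trace_add (hφF.add hψF) hρF,
      trace_add hφF hψF, trace_smul_complex, trace_smul_complex]
    rfl
  have hfφ : Integrable (fun x => f x * (⟪κ x, (φ : XiHilbert H)⟫_ℝ : ℂ)) P :=
    hf.memLp.integrable_mul hφ
  have hfψ : Integrable (fun x => Complex.I * (f x * (⟪κ x, (ψ : XiHilbert H)⟫_ℝ : ℂ))) P :=
    (hf.memLp.integrable_mul hψ).const_mul _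
  have hfT : Integrable (fun x => trace T * f x) P := (hf.memLp.integrable one_le_two).const_mul _
  rw [htrace, ← hf.integral_mul_inner_eq, ← hf.integral_mul_inner_eq, ← hf.integral_eq,
    ← integral_const_mul, ← integral_const_mul, ← integral_add hfφ hfψ,
    ← integral_add (by exact hfφ.add hfψ) hfT]
  refine integral_congr_ae (.of_forall fun x => ?_)
  simp only [Pi.add_apply]
  ring

lemma IsLogGradient.re_trace_star_mul_self_le (hκ : IsLogGradient M ρ₀ θ κ) {f : Ω → ℂ}
    {F : H →L[ℂ] H}
    (hf : IsLocallyUnbiased (outcomeMeasure M (state ρ₀ θ)) (family ρ₀ θ) κ f F) :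
    (trace (family ρ₀ θ * (star F * F))).re ≤ ∫ x, ‖f x‖ ^ 2 ∂outcomeMeasure M (state ρ₀ θ) := by
  have hσ : IsTraceClass (family ρ₀ θ) := (state ρ₀ θ).isTraceClass
  obtain ⟨l, hl, hdensity⟩ := hκ.exists_density (hσ.mul_right (star F))
  simp only [mul_assoc] at hdensity
  have hl_le : ∫ x, ‖l x‖ ^ 2 ∂outcomeMeasure M (state ρ₀ θ)
      ≤ (trace (family ρ₀ θ * (star F * F))).re := by
    refine POVM.integral_norm_sq_le hl fun E hE => ?_
    refine Eq.trans ?_ (hdensity _ _ (hκ.isLocallyUnbiased_indicator hE))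
    rw [← integral_indicator hE]
    refine integral_congr_ae (.of_forall fun x => ?_)
    by_cases hx : x ∈ E <;> simp [hx]
  have hpair := two_mul_re_integral_mul_le hf.memLp hl
  rw [hdensity f F hf] at hpair
  linarith

end LocallyUnbiased

section Uncertainty

lemma norm_sq_le_mul_of_forall_nonneg {α β : ℝ} {z : ℂ}
    (h : ∀ c d : ℂ, 0 ≤ ‖c‖ ^ 2 * α + ‖d‖ ^ 2 * β + 2 * (star c * d * z).re) :
    ‖z‖ ^ 2 ≤ α * β := by
  have hα : 0 ≤ α := by simpa using h 1 0
  have hβ : 0 ≤ β := by simpa using h 0 1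
  rcases eq_or_ne z 0 with rfl | hz
  · simpa using mul_nonneg hα hβ
  have hquad : ∀ t : ℝ, 0 ≤ α * (t * t) + 2 * ‖z‖ ^ 2 * t + ‖z‖ ^ 2 * β := fun t => by
    have hmul : (star (t : ℂ) * star z * z).re = t * ‖z‖ ^ 2 := by
      rw [mul_assoc, ← starRingEnd_apply z, Complex.conj_mul', ← starRingEnd_apply,
        Complex.conj_ofReal, Complex.re_ofReal_mul, ← Complex.ofReal_pow, Complex.ofReal_re]
    have ht := h t (star z)
    rw [hmul, norm_star, Complex.norm_real, Real.norm_eq_abs, sq_abs] at ht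
    linarith
  have hdiscrim := discrim_le_zero hquad
  rw [discrim] at hdiscrim
  have hz_pos : 0 < ‖z‖ ^ 2 := by positivity
  refine le_of_mul_le_mul_left ?_ hz_pos
  linarith

variable {Ω : Type*} [MeasurableSpace Ω]

lemma integral_norm_linearCombination_sq {P : Measure Ω} {f g : Ω → ℂ} (hf : MemLp f 2 P)
    (hg : MemLp g 2 P) (c d : ℂ) :
    ∫ x, ‖c * f x + d * g x‖ ^ 2 ∂P = ‖c‖ ^ 2 * ∫ x, ‖f x‖ ^ 2 ∂P + ‖d‖ ^ 2 * ∫ x, ‖g x‖ ^ 2 ∂P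
      + 2 * (star c * d * ∫ x, star (f x) * g x ∂P).re := by
  have hexpand : ∀ u v : ℂ, ‖c * u + d * v‖ ^ 2
      = ‖c‖ ^ 2 * ‖u‖ ^ 2 + ‖d‖ ^ 2 * ‖v‖ ^ 2 + 2 * (star c * d * (star u * v)).re := fun u v => by
    simp only [← Complex.normSq_eq_norm_sq, Complex.normSq_apply]
    simp only [Complex.add_re, Complex.add_im, Complex.mul_re, Complex.mul_im, RCLike.star_def,
      Complex.conj_re, Complex.conj_im]
    ring
  have hcross : Integrable (fun x => star c * d * (star (f x) * g x)) P :=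
    (hf.star.integrable_mul hg).const_mul _
  have hre : ∫ x, (star c * d * (star (f x) * g x)).re ∂P
      = (∫ x, star c * d * (star (f x) * g x) ∂P).re := integral_re (𝕜 := ℂ) hcross
  have hf_sq := (hf.integrable_norm_pow two_ne_zero).const_mul (‖c‖ ^ 2)
  have hg_sq := (hg.integrable_norm_pow two_ne_zero).const_mul (‖d‖ ^ 2)
  simp only [hexpand]
  rw [integral_add (by exact hf_sq.add hg_sq) (by exact hcross.re.const_mul 2),
    integral_add hf_sq hg_sq, integral_const_mul, integral_const_mul, integral_const_mul, hre,
    integral_const_mul]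

variable {H : Type*} [NormedAddCommGroup H] [InnerProductSpace ℂ H] [CompleteSpace H]

lemma re_trace_mul_linearCombination {σ : H →L[ℂ] H} (hσ : IsTraceClass σ)
    (hsa : IsSelfAdjoint σ) (F G : H →L[ℂ] H) (c d : ℂ) :
    (trace (σ * (star (c • F + d • G) * (c • F + d • G)))).re
      = ‖c‖ ^ 2 * (trace (σ * (star F * F))).re + ‖d‖ ^ 2 * (trace (σ * (star G * G))).re
        + 2 * (star c * d * trace (σ * (star F * G))).re := by
  have hswap : trace (σ * (star G * F)) = star (trace (σ * (star F * G))) := by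
    rw [← trace_mul_star hσ hsa, star_mul, star_star]
  have hre : ∀ F : H →L[ℂ] H, (trace (σ * (star F * F))).im = 0 := fun F => by
    rw [← ofReal_re_trace_mul hσ hsa (IsSelfAdjoint.star_mul_self F), Complex.ofReal_im]
  have hexpand : star (c • F + d • G) * (c • F + d • G)
      = (c * star c) • (star F * F) + (d * star d) • (star G * G)
        + ((star c * d) • (star F * G) + (c * star d) • (star G * F)) := by
    simp only [star_add, star_smul, add_mul, mul_add, smul_mul_assoc, mul_smul_comm]
    module
  simp only [hexpand, ← hσ.traceMul_apply, map_add, map_smul, smul_eq_mul]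
  simp only [hσ.traceMul_apply, hswap, ← Complex.normSq_eq_norm_sq, Complex.normSq_apply]
  simp only [RCLike.star_def, Complex.add_re, Complex.mul_re, Complex.mul_im, Complex.conj_re,
    Complex.conj_im, hre]
  ring

variable {M : POVM Ω H} {ρ₀ : DensityOperator H} {θ : parameterSpace ρ₀} {κ : Ω → XiHilbert H}

lemma IsLogGradient.norm_integral_sub_trace_sq_le (hκ : IsLogGradient M ρ₀ θ κ) {f g : Ω → ℂ}
    {F G : H →L[ℂ] H}
    (hf : IsLocallyUnbiased (outcomeMeasure M (state ρ₀ θ)) (family ρ₀ θ) κ f F)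
    (hg : IsLocallyUnbiased (outcomeMeasure M (state ρ₀ θ)) (family ρ₀ θ) κ g G) :
    ‖∫ x, star (f x) * g x ∂outcomeMeasure M (state ρ₀ θ)
        - trace (family ρ₀ θ * (star F * G))‖ ^ 2
      ≤ (∫ x, ‖f x‖ ^ 2 ∂outcomeMeasure M (state ρ₀ θ)
          - (trace (family ρ₀ θ * (star F * F))).re)
        * (∫ x, ‖g x‖ ^ 2 ∂outcomeMeasure M (state ρ₀ θ)
          - (trace (family ρ₀ θ * (star G * G))).re) := by
  have hσ : IsTraceClass (family ρ₀ θ) := (state ρ₀ θ).isTraceClass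
  refine norm_sq_le_mul_of_forall_nonneg fun c d => ?_
  have h := hκ.re_trace_star_mul_self_le (hf.linearCombination hσ hκ.1 hg c d)
  rw [re_trace_mul_linearCombination hσ (state ρ₀ θ).isPositive.isSelfAdjoint,
    integral_norm_linearCombination_sq hf.memLp hg.memLp] at h
  rw [mul_sub (star c * d), Complex.sub_re]
  linarith

lemma IsLogGradient.integral_eq_zero (hκ : IsLogGradient M ρ₀ θ κ) :
    ∫ x, κ x ∂outcomeMeasure M (state ρ₀ θ) = 0 := by
  refine UniformSpace.Completion.denseRange_coe.eq_zero_of_inner_right ℝ fun φ : Xi H => ?_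
  rw [← integral_inner (hκ.1.integrable one_le_two)]
  have h := hκ.setIntegral_inner MeasurableSet.univ φ
  rw [setIntegral_univ, M.val_univ, mul_one, φ.trace_op, Complex.zero_re] at h
  simpa only [real_inner_comm (κ _)] using h

lemma IsLogGradient.integral_inner_eq_zero (hκ : IsLogGradient M ρ₀ θ κ) (a : XiHilbert H) :
    ∫ x, (⟪κ x, a⟫_ℝ : ℂ) ∂outcomeMeasure M (state ρ₀ θ) = 0 := by
  simp only [fun x => real_inner_comm a (κ x)]
  rw [integral_complex_ofReal, integral_inner (hκ.1.integrable one_le_two), hκ.integral_eq_zero,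
    inner_zero_right, Complex.ofReal_zero]

lemma IsLogGradient.integral_inner_add_mul_inner_add (hκ : IsLogGradient M ρ₀ θ κ)
    (a b : XiHilbert H) (m n : ℂ) :
    ∫ x, ((⟪κ x, a⟫_ℝ : ℂ) + m) * ((⟪κ x, b⟫_ℝ : ℂ) + n) ∂outcomeMeasure M (state ρ₀ θ)
      = (⟪fisherOperator (outcomeMeasure M (state ρ₀ θ)) κ a, b⟫_ℝ : ℂ) + m * n := by
  set P := outcomeMeasure M (state ρ₀ θ)
  have ha := memLp_inner_const hκ.1 a
  have hb := memLp_inner_const hκ.1 b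
  have hab : Integrable (fun x => (⟪κ x, a⟫_ℝ : ℂ) * (⟪κ x, b⟫_ℝ : ℂ)) P := ha.integrable_mul hb
  have hlin : Integrable (fun x => n * (⟪κ x, a⟫_ℝ : ℂ) + m * (⟪κ x, b⟫_ℝ : ℂ)) P :=
    ((ha.integrable one_le_two).const_mul n).add ((hb.integrable one_le_two).const_mul m)
  have hexpand : ∀ x, ((⟪κ x, a⟫_ℝ : ℂ) + m) * ((⟪κ x, b⟫_ℝ : ℂ) + n)
      = (⟪κ x, a⟫_ℝ : ℂ) * (⟪κ x, b⟫_ℝ : ℂ)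
        + (n * (⟪κ x, a⟫_ℝ : ℂ) + m * (⟪κ x, b⟫_ℝ : ℂ)) + m * n := fun x => by ring
  simp only [hexpand]
  rw [integral_add (by exact hab.add hlin) (integrable_const _), integral_add hab hlin,
    integral_add ((ha.integrable one_le_two).const_mul n) ((hb.integrable one_le_two).const_mul m),
    integral_const_mul, integral_const_mul, hκ.integral_inner_eq_zero, hκ.integral_inner_eq_zero,
    inner_fisherOperator hκ.1, ← integral_complex_ofReal]
  simp [P]

lemma IsLogGradient.isLocallyUnbiased_score (hκ : IsLogGradient M ρ₀ θ κ) {X : H →L[ℂ] H}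
    {a : XiHilbert H} (ha : ∀ φ : Xi H,
      (⟪fisherOperator (outcomeMeasure M (state ρ₀ θ)) κ a, (φ : XiHilbert H)⟫_ℝ : ℂ)
        = trace (φ.op * X)) :
    IsLocallyUnbiased (outcomeMeasure M (state ρ₀ θ)) (family ρ₀ θ) κ
      (fun x => (⟪κ x, a⟫_ℝ : ℂ) + trace (family ρ₀ θ * X)) X where
  memLp := (memLp_inner_const hκ.1 a).add (memLp_const _)
  integral_eq := by
    rw [integral_add ((memLp_inner_const hκ.1 a).integrable one_le_two) (integrable_const _),
      hκ.integral_inner_eq_zero]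
    simp
  integral_mul_inner_eq φ := by
    simpa [ha] using hκ.integral_inner_add_mul_inner_add a φ (trace (family ρ₀ θ * X)) 0

lemma IsLogGradient.integral_star_score_mul_score_sub (hκ : IsLogGradient M ρ₀ θ κ)
    {X : H →L[ℂ] H} (hX : IsSelfAdjoint X) (Y : H →L[ℂ] H) (a b : XiHilbert H) :
    ∫ x, star ((⟪κ x, a⟫_ℝ : ℂ) + trace (family ρ₀ θ * X))
        * ((⟪κ x, b⟫_ℝ : ℂ) + trace (family ρ₀ θ * Y)) ∂outcomeMeasure M (state ρ₀ θ)
        - trace (family ρ₀ θ * (star X * Y))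
      = (⟪fisherOperator (outcomeMeasure M (state ρ₀ θ)) κ a, b⟫_ℝ : ℂ)
        - correlation (family ρ₀ θ) ((X : H →ₗ[ℂ] H).toPMap ⊤) ((Y : H →ₗ[ℂ] H).toPMap ⊤) := by
  have hσ : IsTraceClass (family ρ₀ θ) := (state ρ₀ θ).isTraceClass
  have hmean : star (trace (family ρ₀ θ * X)) = trace (family ρ₀ θ * X) := by
    rw [← trace_mul_star hσ (state ρ₀ θ).isPositive.isSelfAdjoint, hX.star_eq]
  have hstar : ∀ r : ℝ, star (r : ℂ) = r := Complex.conj_ofReal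
  simp only [star_add, hmean, hstar]
  rw [hκ.integral_inner_add_mul_inner_add, correlation_toPMap hσ, hX.star_eq]
  ring

lemma ofReal_integral_norm_sq (P : Measure Ω) (f : Ω → ℂ) :
    ((∫ x, ‖f x‖ ^ 2 ∂P : ℝ) : ℂ) = ∫ x, star (f x) * f x ∂P := by
  rw [← integral_complex_ofReal]
  refine integral_congr_ae (.of_forall fun x => ?_)
  simpa using (Complex.conj_mul' (f x)).symm

lemma IsLogGradient.integral_norm_score_sq_sub (hκ : IsLogGradient M ρ₀ θ κ) {X : H →L[ℂ] H}
    (hX : IsSelfAdjoint X) (a : XiHilbert H) :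
    ∫ x, ‖(⟪κ x, a⟫_ℝ : ℂ) + trace (family ρ₀ θ * X)‖ ^ 2 ∂outcomeMeasure M (state ρ₀ θ)
        - (trace (family ρ₀ θ * (star X * X))).re
      = ⟪fisherOperator (outcomeMeasure M (state ρ₀ θ)) κ a, a⟫_ℝ
        - variance (family ρ₀ θ) ((X : H →ₗ[ℂ] H).toPMap ⊤) := by
  have h := congrArg Complex.re (hκ.integral_star_score_mul_score_sub hX X a a)
  rwa [← ofReal_integral_norm_sq, Complex.sub_re, Complex.sub_re, Complex.ofReal_re,
    Complex.ofReal_re] at h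

lemma IsLogGradient.norm_inner_sub_correlation_sq_le (hκ : IsLogGradient M ρ₀ θ κ)
    {X Y : H →L[ℂ] H} (hX : IsSelfAdjoint X) (hY : IsSelfAdjoint Y) {a b : XiHilbert H}
    (ha : ∀ φ : Xi H,
      (⟪fisherOperator (outcomeMeasure M (state ρ₀ θ)) κ a, (φ : XiHilbert H)⟫_ℝ : ℂ)
        = trace (φ.op * X))
    (hb : ∀ φ : Xi H,
      (⟪fisherOperator (outcomeMeasure M (state ρ₀ θ)) κ b, (φ : XiHilbert H)⟫_ℝ : ℂ)
        = trace (φ.op * Y)) :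
    ‖(⟪fisherOperator (outcomeMeasure M (state ρ₀ θ)) κ a, b⟫_ℝ : ℂ)
        - correlation (family ρ₀ θ) ((X : H →ₗ[ℂ] H).toPMap ⊤) ((Y : H →ₗ[ℂ] H).toPMap ⊤)‖ ^ 2
      ≤ (⟪fisherOperator (outcomeMeasure M (state ρ₀ θ)) κ a, a⟫_ℝ
          - variance (family ρ₀ θ) ((X : H →ₗ[ℂ] H).toPMap ⊤))
        * (⟪fisherOperator (outcomeMeasure M (state ρ₀ θ)) κ b, b⟫_ℝ
          - variance (family ρ₀ θ) ((Y : H →ₗ[ℂ] H).toPMap ⊤)) := by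
  have h := hκ.norm_integral_sub_trace_sq_le (hκ.isLocallyUnbiased_score ha)
    (hκ.isLocallyUnbiased_score hb)
  rwa [hκ.integral_star_score_mul_score_sub hX, hκ.integral_norm_score_sq_sub hX,
    hκ.integral_norm_score_sq_sub hY] at h

lemma correlation_toPMap_comm {σ : H →L[ℂ] H} (hσ : IsTraceClass σ) (hsa : IsSelfAdjoint σ)
    {X Y : H →L[ℂ] H} (hX : IsSelfAdjoint X) (hY : IsSelfAdjoint Y) :
    correlation σ ((Y : H →ₗ[ℂ] H).toPMap ⊤) ((X : H →ₗ[ℂ] H).toPMap ⊤)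
      = star (correlation σ ((X : H →ₗ[ℂ] H).toPMap ⊤) ((Y : H →ₗ[ℂ] H).toPMap ⊤)) := by
  simp only [correlation_toPMap hσ, star_sub, star_mul', ← trace_mul_star hσ hsa, star_mul,
    hX.star_eq, hY.star_eq]
  ring

lemma expectation_opCommutator_toPMap {σ : H →L[ℂ] H} (hσ : IsTraceClass σ) (X Y : H →L[ℂ] H) :
    expectation σ (opCommutator ((X : H →ₗ[ℂ] H).toPMap ⊤) ((Y : H →ₗ[ℂ] H).toPMap ⊤))
      = correlation σ ((X : H →ₗ[ℂ] H).toPMap ⊤) ((Y : H →ₗ[ℂ] H).toPMap ⊤)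
        - correlation σ ((Y : H →ₗ[ℂ] H).toPMap ⊤) ((X : H →ₗ[ℂ] H).toPMap ⊤) := by
  rw [opCommutator_toPMap, expectation_toPMap hσ, correlation_toPMap hσ, correlation_toPMap hσ,
    mul_sub, trace_sub (hσ.mul_right _) (hσ.mul_right _)]
  ring

lemma residualCorrelation_sq_add {σ : H →L[ℂ] H} (hσ : IsTraceClass σ) (hsa : IsSelfAdjoint σ)
    {X Y : H →L[ℂ] H} (hX : IsSelfAdjoint X) (hY : IsSelfAdjoint Y)
    {S : XiHilbert H →ₗ.[ℝ] XiHilbert H} (gA gB : S.domain) :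
    residualCorrelation σ ((X : H →ₗ[ℂ] H).toPMap ⊤) ((Y : H →ₗ[ℂ] H).toPMap ⊤) S gA gB ^ 2
        + 1 / 4 * ‖expectation σ
          (opCommutator ((X : H →ₗ[ℂ] H).toPMap ⊤) ((Y : H →ₗ[ℂ] H).toPMap ⊤))‖ ^ 2
      = ‖(⟪(gA : XiHilbert H), S gB⟫_ℝ : ℂ)
        - correlation σ ((X : H →ₗ[ℂ] H).toPMap ⊤) ((Y : H →ₗ[ℂ] H).toPMap ⊤)‖ ^ 2 := by
  rw [residualCorrelation, symCorrelation, expectation_opCommutator_toPMap hσ,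
    correlation_toPMap_comm hσ hsa hX hY]
  simp only [← Complex.normSq_eq_norm_sq, Complex.normSq_apply]
  simp only [Complex.mul_re, Complex.sub_re, Complex.sub_im, Complex.add_re, Complex.add_im,
    Complex.ofReal_re, Complex.ofReal_im, RCLike.star_def, Complex.conj_re, Complex.conj_im,
    one_div, Complex.inv_re, Complex.inv_im, Complex.re_ofNat, Complex.im_ofNat,
    Complex.normSq_ofNat]
  ring

lemma le_errorMul_measurementError {σ : H →L[ℂ] H} {A B : H →ₗ.[ℂ] H}
    {J : XiHilbert H →L[ℝ] XiHilbert H} {S : XiHilbert H →ₗ.[ℝ] XiHilbert H} {gA gB : S.domain}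
    {r : ℝ}
    (h : (gA : XiHilbert H) ∈ (LinearMap.ker J.toLinearMap)ᗮ →
      (gB : XiHilbert H) ∈ (LinearMap.ker J.toLinearMap)ᗮ →
      r ≤ (⟪(gA : XiHilbert H), S gA⟫_ℝ - variance σ A)
        * (⟪(gB : XiHilbert H), S gB⟫_ℝ - variance σ B)) :
    (r : EReal) ≤ errorMul (measurementError σ A J S gA) (measurementError σ B J S gB) := by
  by_cases hA : (gA : XiHilbert H) ∈ (LinearMap.ker J.toLinearMap)ᗮ
  · by_cases hB : (gB : XiHilbert H) ∈ (LinearMap.ker J.toLinearMap)ᗮ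
    · rw [measurementError, measurementError, if_pos hA, if_pos hB, errorMul,
        if_neg (not_or.mpr ⟨EReal.coe_ne_top _, EReal.coe_ne_top _⟩), ← EReal.coe_mul]
      exact EReal.coe_le_coe_iff.mpr (h hA hB)
    · simp [errorMul, measurementError, hB]
  · simp [errorMul, measurementError, hA]

end Uncertainty

end QuantumEstimation

theorem mainTheorem2 {H : Type*} [NormedAddCommGroup H] [InnerProductSpace ℂ H] [CompleteSpace H]
    [TopologicalSpace.SeparableSpace H] {Ω : Type*} [MeasurableSpace Ω]
    (ρ₀ : DensityOperator H) (θ : parameterSpace ρ₀)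
    (M : POVM Ω H)
    (κ : Ω → XiHilbert H) (hκ : IsLogGradient M ρ₀ θ κ)
    (J : XiHilbert H →L[ℝ] XiHilbert H)
    (hJ : J = fisherOperator
      (outcomeMeasure M (state ρ₀ θ)) κ)
    (S : XiHilbert H →ₗ.[ℝ] XiHilbert H)
    (hS : IsMoorePenroseInverse J S)
    (σ : H →L[ℂ] H) (hσ : σ = family ρ₀ θ)
    (A B : H →ₗ.[ℂ] H)
    (hA : A ∈ observables σ) (hB : B ∈ observables σ)
    (hAA : opMul A A ∈ finiteExpectation σ)
    (hBB : opMul B B ∈ finiteExpectation σ)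
    (hAB : opMul A B ∈ finiteExpectation σ)
    (gA gB : S.domain)
    (hgA : IsExpectationGradient ρ₀ θ A gA)
    (hgB : IsExpectationGradient ρ₀ θ B gB) :
    ((residualCorrelation σ A B S gA gB ^ 2
        + 1 / 4 * ‖expectation σ (opCommutator A B)‖ ^ 2 : ℝ) :
          EReal) ≤
      errorMul (measurementError σ A J S gA)
        (measurementError σ B J S gB) := by
  subst hJ hσ
  refine le_errorMul_measurementError fun hkA hkB => ?_
  obtain ⟨X, hX, rfl, hgX⟩ := hgA.exists_bounded hA
  obtain ⟨Y, hY, rfl, hgY⟩ := hgB.exists_bounded hB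
  have hJ := inner_fisherOperator_comm hκ.1
  have hJA := hS.apply_apply_of_mem_orthogonal_ker hJ hkA
  have hJB := hS.apply_apply_of_mem_orthogonal_ker hJ hkB
  have hσ : IsTraceClass (family ρ₀ θ) := (state ρ₀ θ).isTraceClass
  have h := hκ.norm_inner_sub_correlation_sq_le hX hY (a := S gA) (b := S gB)
    (by simpa only [hJA] using hgX) (by simpa only [hJB] using hgY)
  rwa [hJA, hJB, ← residualCorrelation_sq_add hσ
    (state ρ₀ θ).isPositive.isSelfAdjoint hX hY] at h
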